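/- **Setting.** Let $G$ be a finite turn-based stochastic Rabin game: a finite state space $S$ split into system states $S_s$ and environment states $S_e=S\setminus S_s$, a set $I\subseteq S$ of initial states, a finite action set $A$, a nonempty set $A^G(s)\subseteq A$ of available actions at each state $s$, transition distributions $T(s,a)$ on $S$, and finitely many Rabin pairs $(E_i,F_i)$ of disjoint subsets of $S$. A run is winning if, for some $i$, it visits some state of $F_i$ infinitely often and every state of $E_i$ only finitely often. Let $\mathcal R:S\times A\times S\to\mathbb R_{\ge 0}$ be a reward function and $\gamma\in(0,1)$ a discount factor. A strategy of a player consists of a countable set $M$ of memory states, an initial memory state, a memory update function $S\times M\to M$, and, for each state $s$ of that player and each $m\in M$, a probability distribution on $A^G(s)$; it is memoryless if $|M|=1$. For a memoryless system strategy $\sigma$ let $A_\sigma(s)$ be the set of actions that $\sigma$ chooses with positive probability at $s\in S_s$. A system strategy is almost-sure winning if, against every environment strategy and from every $s\in I$, the run is winning with probability $1$. Let $V(s,\sigma,\tau)$ be the expected value of $\sum_{t\ge 0}\gamma^t\mathcal R(s^t,a^{t+1},s^{t+1})$ along the run $s^0=s, a^1, s^1, a^2,\dots$ when the system plays $\sigma$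 and the environment plays $\tau$ ($a^{t+1}$ is the action taken at $s^t$). Put $\tilde V(s,\sigma)=\inf_\tau V(s,\sigma,\tau)$ and $V^*(s)=\sup_\sigma\tilde V(s,\sigma)$, where $\tau$ and $\sigma$ range over all environment and all system strategies. A system strategy $\sigma$ is $\varepsilon$-optimal if $\tilde V(s,\sigma)\ge V^*(s)-\varepsilon$ for all $s\in S$. Finally let $$A^*(s)=\arg\max_{a\in A^G(s)}\sum_{s'\in S}T(s,a)(s')\bigl(\mathcal R(s,a,s')+\gamma V^*(s')\bigr)$$ be the set of optimal actions at $s\in S_s$. **Theorem.** Consider the condition (C) there is a memoryless almost-sure winning system strategy $\sigma$ with $A_\sigma(s)\cap A^*(s)\neq\emptyset$ for all $s\in S_s$. 1. Suppose that from every state $s \in S$ the system has a strategy that wins with probability $1$ against every environment strategy (the almost-sure winning region is all of $S$). Then memoryless strategies suffice for being both almost-sure winning and $\varepsilon$-optimal for all $\varepsilon>0$ simultaneously (that is, for every $\varepsilon>0$, if some system strategy is almost-sure winning and $\varepsilon$-optimal, then some memoryless system strategy is) if and only if (C) holds. 2. Without that supposition, the following two statements are equivalent: (a) for every $\varepsilon>0$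 there exists a memoryless system strategy that is both almost-sure winning and $\varepsilon$-optimal; (b) condition (C) holds. -/

import Mathlib

open MeasureTheory ProbabilityTheory Filter

noncomputable section

/-- A turn-based stochastic Rabin game with state space `S` and action set `A`.
The environment states are the complement of `sys`. -/
structure RabinGame (S A : Type*) where
  /-- states at which the system chooses the action -/
  sys : Set S
  /-- initial states -/
  init : Set S
  /-- available actions -/
  avail : S → Set A
  avail_nonempty : ∀ s, (avail s).Nonempty
  /-- transition distributions -/
  trans : S → A → PMF S
  /-- number of Rabin pairs `(E i, F i)` -/
  numPairs : ℕ
  E : Fin numPairs → Set S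
  F : Fin numPairs → Set S
  disjoint_pairs : ∀ i, Disjoint (E i) (F i)

/-- A state together with the action taken at it: one entry of a run. -/
structure Step (S A : Type*) where
  state : S
  action : A

instance (S A : Type*) : MeasurableSpace (Step S A) := ⊤

/-- A state, the action taken at it, and the current memory states of the two players. -/
structure Config (S A M N : Type*) where
  state : S
  action : A
  memSys : M
  memEnv : N

instance (S A M N : Type*) : MeasurableSpace (Config S A M N) := ⊤

namespace RabinGame

variable {S A : Type*}

/-- A (randomized) strategy of the player who controls the states in `own`: a countable set of
memory states, an initial memory state, a distribution on the available actions for each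
controlled state and memory state, and a memory update function on all states. -/
structure Strategy (G : RabinGame S A) (own : Set S) where
  Mem : Type
  countable_mem : Countable Mem
  memInit : Mem
  choose : own → Mem → PMF A
  choose_avail : ∀ (s : own) (m : Mem), ∀ a ∈ (choose s m).support, a ∈ G.avail s
  update : S → Mem → Mem

/-- Strategies for the system. -/
abbrev SysStrategy (G : RabinGame S A) := G.Strategy G.sys

/-- Strategies for the environment. -/
abbrev EnvStrategy (G : RabinGame S A) := G.Strategy G.sysᶜ

/-- A strategy is memoryless if its set of memory states is a singleton. -/
def Strategy.Memoryless {G : RabinGame S A} {own : Set S} (σ : G.Strategy own) : Prop :=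
  Nonempty (Unique σ.Mem)

/-- The actions that a strategy allows at a controlled state with its initial memory
(for a memoryless strategy: the actions allowed at that state). -/
def Strategy.allowed {G : RabinGame S A} {own : Set S} (σ : G.Strategy own) (s : own) : Set A :=
  {a | a ∈ G.avail s ∧ 0 < σ.choose s σ.memInit a}

section Law

variable (G : RabinGame S A) (σ : G.SysStrategy) (τ : G.EnvStrategy)

open scoped Classical in
/-- The distribution of the next action, chosen by the player who controls the state. -/
def actionDist (s : S) (m : σ.Mem) (n : τ.Mem) : PMF A :=
  if h : s ∈ G.sys then σ.choose ⟨s, h⟩ m else τ.choose ⟨s, h⟩ n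

/-- The distribution of the configuration in state `s` with memory states `m` and `n`. -/
def enter (s : S) (m : σ.Mem) (n : τ.Mem) : PMF (Config S A σ.Mem τ.Mem) :=
  (G.actionDist σ τ s m n).map fun a => ⟨s, a, m, n⟩

/-- The one-step transition probabilities: the next state is drawn from the transition
distribution, both memories are updated with the state just left, and the next action is drawn. -/
def stepDist (c : Config S A σ.Mem τ.Mem) : PMF (Config S A σ.Mem τ.Mem) :=
  (G.trans c.state c.action).bind fun s' =>
    G.enter σ τ s' (σ.update c.state c.memSys) (τ.update c.state c.memEnv)

/-- The one-step transition kernel, as a function of the history up to time `n`. -/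
def stepKernel (n : ℕ) :
    Kernel (Π _ : Finset.Iic n, Config S A σ.Mem τ.Mem) (Config S A σ.Mem τ.Mem) where
  toFun h := (G.stepDist σ τ (h ⟨n, Finset.mem_Iic.2 le_rfl⟩)).toMeasure
  measurable' :=
    (measurable_from_top (f := fun c => (G.stepDist σ τ c).toMeasure)).comp (measurable_pi_apply _)

instance (n : ℕ) : IsMarkovKernel (G.stepKernel σ τ n) :=
  ⟨fun h => inferInstanceAs
    (IsProbabilityMeasure (G.stepDist σ τ (h ⟨n, Finset.mem_Iic.2 le_rfl⟩)).toMeasure)⟩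

/-- The law of the sequence of configurations from the state `s`: the Markov chain with
transition probabilities `stepDist`, started with both initial memory states. -/
def configLaw (s : S) : Measure (ℕ → Config S A σ.Mem τ.Mem) :=
  Kernel.trajMeasure (X := fun _ => Config S A σ.Mem τ.Mem)
    (G.enter σ τ s σ.memInit τ.memInit).toMeasure (G.stepKernel σ τ)

/-- The law of the run from the state `s` under the pair of strategies `(σ, τ)`. -/
def runLaw (s : S) : Measure (ℕ → Step S A) :=
  (G.configLaw σ τ s).map fun ω i => ⟨(ω i).state, (ω i).action⟩

end Law

/-- The states visited infinitely often in a run. -/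
def infStates (π : ℕ → Step S A) : Set S :=
  {s | ∃ᶠ i in atTop, (π i).state = s}

/-- The runs that satisfy the Rabin condition. -/
def winningRuns (G : RabinGame S A) : Set (ℕ → Step S A) :=
  {π | ∃ i, (infStates π ∩ G.F i).Nonempty ∧ infStates π ∩ G.E i = ∅}

/-- `σ` wins with probability one from the state `s`, whatever the environment does. -/
def WinsFrom (G : RabinGame S A) (σ : G.SysStrategy) (s : S) : Prop :=
  ∀ τ : G.EnvStrategy, G.runLaw σ τ s G.winningRuns = 1

/-- `σ` is almost-sure winning: it wins with probability one from all initial states. -/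
def AlmostSureWinning (G : RabinGame S A) (σ : G.SysStrategy) : Prop :=
  ∀ s ∈ G.init, G.WinsFrom σ s

/-- The states from which the system can win with probability one. -/
def almostSureRegion (G : RabinGame S A) : Set S :=
  {s | ∃ σ : G.SysStrategy, G.WinsFrom σ s}

/-- The discounted reward of a run. -/
def discountedReward (R : S → A → S → ℝ) (γ : ℝ) (π : ℕ → Step S A) : ℝ :=
  ∑' t : ℕ, γ ^ t * R (π t).state (π t).action (π (t + 1)).state

section Value

variable (G : RabinGame S A) (R : S → A → S → ℝ) (γ : ℝ)

/-- The expected discounted reward of a pair of strategies from the state `s`. -/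
def value (s : S) (σ : G.SysStrategy) (τ : G.EnvStrategy) : ℝ :=
  ∫ π, discountedReward R γ π ∂(G.runLaw σ τ s)

/-- The value of a system strategy: the worst case over all environment strategies. -/
def strategyValue (s : S) (σ : G.SysStrategy) : ℝ :=
  ⨅ τ : G.EnvStrategy, G.value R γ s σ τ

/-- The optimal value over all system strategies. -/
def optimalValue (s : S) : ℝ :=
  ⨆ σ : G.SysStrategy, G.strategyValue R γ s σ

/-- `σ` is `ε`-optimal over all system strategies, at every state. -/
def EpsOptimal (ε : ℝ) (σ : G.SysStrategy) : Prop :=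
  ∀ s, G.optimalValue R γ s - ε ≤ G.strategyValue R γ s σ

/-- The expected reward of the action `a` at `s` if play is worth the optimal value afterwards. -/
def actionValue [Fintype S] (s : S) (a : A) : ℝ :=
  ∑ s', (G.trans s a s').toReal * (R s a s' + γ * G.optimalValue R γ s')

/-- The optimal actions at `s`: the maximizers of `actionValue` among the available actions. -/
def optimalActions [Fintype S] (s : S) : Set A :=
  {a | a ∈ G.avail s ∧ ∀ b ∈ G.avail s, G.actionValue R γ s b ≤ G.actionValue R γ s a}

end Value

/-- A class `C` of system strategies suffices for an objective `O`: if some system strategy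
satisfies `O`, then some system strategy in `C` does. -/
def Suffices (G : RabinGame S A) (C O : G.SysStrategy → Prop) : Prop :=
  (∃ σ, O σ) → ∃ σ, C σ ∧ O σ

/-- Some memoryless almost-sure winning system strategy allows at least one optimal action at
every system state. -/
def MemorylessWinningAllowsOptimal [Fintype S] (G : RabinGame S A) (R : S → A → S → ℝ)
    (γ : ℝ) : Prop :=
  ∃ σ : G.SysStrategy, σ.Memoryless ∧ G.AlmostSureWinning σ ∧
    ∀ s : G.sys, (σ.allowed s ∩ G.optimalActions R γ s).Nonempty

end RabinGame

end

/-! The link between winning and reward is that the two depend on different data of a memoryless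
strategy. Almost-sure winning depends only on the supports of its distributions
(`WinsFrom.congr_support`), while the value depends continuously on the probabilities.

For the support statement, fix the memoryless system strategy. Almost surely, the state-action pairs
that recur in a run form an end component of the remaining decision process. If a losing run has
positive probability, some losing typical run exhibits a reachable end component with a losing set
of states. Against any strategy with the same supports, the environment can randomize over that
component and visit exactly its states infinitely often, with positive probability
(`IsEndComponent.not_winsFrom`).

The optimal value is the fixed point `W` of the discounted optimality operator. Given (C), put
weight `1 - δ` on an allowed optimal action and weight `δ` on the old distribution. Supports, hence
winning, are unchanged. `W` satisfies the Bellman inequality of the new strategy up to an error of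
order `δ`, which costs at most that error divided by `1 - γ`. Conversely, there are finitely many
pairs of state and action, so suboptimal system actions fall short of `W` by a uniform gap `η`. A
strategy that allows no optimal action at some state loses `η` at its first step there against an
optimal environment strategy, so it is not `η / 2`-optimal (`exists_eps_forall_allowed`).

This proves the second equivalence. For the first, the premise hidden in sufficiency must be
supplied: when every state can be won almost surely, playing optimally for long and then switching
to winning strategies is both almost-sure winning and `ε`-optimal. The Rabin condition ignores
finite prefixes, and nonnegative rewards make the tail harmless. -/

noncomputable section

/-! ### Laws of countable Markov chains and their first-step decomposition -/

namespace MarkovChain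

open Preorder

section Sequences

variable {C : Type*}

/-- The sequences that agree with `x` up to time `n`. -/
def cyl (x : ℕ → C) (n : ℕ) : Set (ℕ → C) := {ω | ∀ i ≤ n, ω i = x i}

lemma cyl_eq_preimage (x : ℕ → C) (n : ℕ) :
    cyl x n = frestrictLe (π := fun _ => C) n ⁻¹' {frestrictLe n x} := by
  ext ω
  simp [cyl, funext_iff]

/-- Put a state in front of a sequence. -/
def cons (c : C) (ω : ℕ → C) : ℕ → C
  | 0 => c
  | n + 1 => ω n

@[simp] lemma cons_zero (c : C) (ω : ℕ → C) : cons c ω 0 = c := rfl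

@[simp] lemma cons_succ (c : C) (ω : ℕ → C) (n : ℕ) : cons c ω (n + 1) = ω n := rfl

lemma cons_preimage_cyl_zero (c : C) (x : ℕ → C) :
    cons c ⁻¹' cyl x 0 = {_ω | c = x 0} := by
  ext ω; simp [cyl]

lemma cons_preimage_cyl_succ (c : C) (x : ℕ → C) (n : ℕ) :
    cons c ⁻¹' cyl x (n + 1) = {ω | c = x 0 ∧ ω ∈ cyl (fun i => x (i + 1)) n} := by
  ext ω
  simp only [cyl, Set.mem_preimage, Set.mem_ofPred_eq]
  constructor
  · exact fun h => ⟨h 0 (by omega), fun i hi => h (i + 1) (by omega)⟩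
  · rintro ⟨h0, h1⟩ (_ | i) hi
    · exact h0
    · exact h1 i (by omega)

end Sequences

variable {C : Type*} [MeasurableSpace C]

@[fun_prop]
lemma measurable_cons (c : C) : Measurable (cons c) := by
  rw [measurable_pi_iff]
  rintro (_ | n)
  · exact measurable_const
  · exact measurable_pi_apply n

lemma measurableSet_cyl [DiscreteMeasurableSpace C] (x : ℕ → C) (n : ℕ) : MeasurableSet (cyl x n) := by
  have : cyl x n = ⋂ i, ⋂ (_ : i ≤ n), (fun ω : ℕ → C => ω i) ⁻¹' {x i} := by
    ext; simp [cyl]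
  rw [this]
  exact MeasurableSet.iInter fun i => MeasurableSet.iInter fun _ =>
    measurable_pi_apply i (MeasurableSet.of_discrete)

variable [Countable C] [DiscreteMeasurableSpace C]

/-- The transition kernel of a Markov chain, as a function of the history. -/
def kernel (P : C → PMF C) (n : ℕ) : Kernel (Π _ : Finset.Iic n, C) C where
  toFun h := (P (h ⟨n, Finset.mem_Iic.2 le_rfl⟩)).toMeasure
  measurable' := (measurable_of_countable (fun c => (P c).toMeasure)).comp (measurable_pi_apply _)

instance (P : C → PMF C) (n : ℕ) : IsMarkovKernel (kernel P n) :=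
  ⟨fun _ => by dsimp [kernel]; infer_instance⟩

/-- The law of the Markov chain with initial distribution `μ`. -/
def lawFrom (P : C → PMF C) (μ : Measure C) : Measure (ℕ → C) :=
  Kernel.trajMeasure (X := fun _ => C) μ (kernel P)

/-- The law of the Markov chain started at `c`. -/
def law (P : C → PMF C) (c : C) : Measure (ℕ → C) := lawFrom P (Measure.dirac c)

instance (P : C → PMF C) (μ : Measure C) [IsProbabilityMeasure μ] :
    IsProbabilityMeasure (lawFrom P μ) := by
  unfold lawFrom; infer_instance

instance (P : C → PMF C) (c : C) : IsProbabilityMeasure (law P c) := by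
  unfold law; infer_instance

/-- On a countable space, cylinders determine the marginals on initial segments, hence all finite
marginals, hence the law as a projective limit. -/
lemma ext_cyl [Nonempty C] {μ ν : Measure (ℕ → C)} [IsFiniteMeasure μ] [IsFiniteMeasure ν]
    (h : ∀ x n, μ (cyl x n) = ν (cyl x n)) : μ = ν := by
  have hn : ∀ n : ℕ, μ.map (frestrictLe (π := fun _ => C) n) = ν.map (frestrictLe n) := by
    intro n
    apply Measure.ext_of_singleton
    intro y
    rw [Measure.map_apply (by fun_prop) (measurableSet_singleton y),
      Measure.map_apply (by fun_prop) (measurableSet_singleton y)]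
    -- Every finite history is the restriction of a sequence; the value after time `n` is arbitrary.
    have : frestrictLe (π := fun _ => C) n
        (fun i => if hi : i ≤ n then y ⟨i, Finset.mem_Iic.2 hi⟩ else Classical.arbitrary C) = y := by
      ext i
      have := Finset.mem_Iic.1 i.2
      simp [this]
    rw [← this, ← cyl_eq_preimage]
    exact h _ _
  have hp : ∀ I : Finset ℕ, μ.map (I.restrict (π := fun _ => C)) = ν.map (I.restrict (π := fun _ => C)) := by
    intro I
    have hI : I ⊆ Finset.Iic (I.sup id) := fun i hi => Finset.mem_Iic.2 (Finset.le_sup (f := id) hi)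
    have hc : I.restrict (π := fun _ => C) =
        Finset.restrict₂ (π := fun _ => C) hI ∘ frestrictLe (π := fun _ => C) (I.sup id) := rfl
    rw [hc, ← Measure.map_map (by fun_prop) (by fun_prop), hn,
      Measure.map_map (by fun_prop) (by fun_prop)]
  exact IsProjectiveLimit.unique (ι := ℕ) (α := fun _ => C)
    (P := fun I : Finset ℕ => ν.map (I.restrict (π := fun _ => C))) hp (fun I => rfl)

lemma lawFrom_cyl_zero (P : C → PMF C) (μ : Measure C) [IsProbabilityMeasure μ] (x : ℕ → C) :
    lawFrom P μ (cyl x 0) = μ {x 0} := by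
  have h0 : lawFrom P μ (cyl x 0) =
      (lawFrom P μ).map (frestrictLe (π := fun _ => C) 0) {frestrictLe 0 x} := by
    rw [Measure.map_apply (by fun_prop) (measurableSet_singleton _), cyl_eq_preimage]
  rw [h0, lawFrom, Kernel.trajMeasure, Measure.map_comp _ _ (by fun_prop),
    Kernel.traj_map_frestrictLe, Kernel.partialTraj_self, Measure.id_comp,
    Measure.map_apply (by fun_prop) (measurableSet_singleton _)]
  congr 1
  ext y
  simp only [Set.mem_preimage, Set.mem_singleton_iff]
  constructor
  · intro h
    have := congrFun h ⟨0, by simp⟩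
    simpa using this
  · rintro rfl
    ext ⟨i, hi⟩
    have : i = 0 := by simpa using hi
    subst this
    rfl

/-- The joint law of the history up to `n` and the next state is a composition product; here it is
evaluated at a product of singletons. -/
lemma lawFrom_cyl_succ (P : C → PMF C) (μ : Measure C) [IsProbabilityMeasure μ] (x : ℕ → C)
    (n : ℕ) : lawFrom P μ (cyl x (n + 1)) = lawFrom P μ (cyl x n) * P (x n) (x (n + 1)) := by
  have h := Kernel.map_frestrictLe_trajMeasure_compProd_eq_map_trajMeasure
    (X := fun _ => C) (κ := kernel P) (μ₀ := μ) (a := n)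
  have h2 := congrArg
    (fun ν => ν (({frestrictLe n x} : Set (Π _ : Finset.Iic n, C)) ×ˢ ({x (n + 1)} : Set C))) h
  rw [Measure.compProd_apply_prod (measurableSet_singleton _) (measurableSet_singleton _),
    Measure.map_apply (by fun_prop)
      ((measurableSet_singleton _).prod (measurableSet_singleton _)),
    lintegral_singleton, Measure.map_apply (by fun_prop) (measurableSet_singleton _),
    ← cyl_eq_preimage] at h2
  rw [mul_comm]
  have h3 : kernel P n (frestrictLe n x) {x (n + 1)} = P (x n) (x (n + 1)) := by
    change (P (x n)).toMeasure {x (n + 1)} = _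
    rw [PMF.toMeasure_apply_singleton _ _ (measurableSet_singleton _)]
  rw [h3] at h2
  unfold lawFrom
  rw [h2]
  congr 1
  ext ω
  simp only [cyl, Set.mem_ofPred_eq, Set.mem_preimage, Set.mem_prod, Set.mem_singleton_iff,
    funext_iff]
  constructor
  · exact fun h => ⟨fun i => h i (by have := Finset.mem_Iic.1 i.2; omega), h _ le_rfl⟩
  · rintro ⟨h1, h2⟩ i hi
    rcases Nat.le_succ_iff.1 hi with hi | rfl
    · exact h1 ⟨i, Finset.mem_Iic.2 hi⟩
    · exact h2

open scoped Classical in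
lemma law_cyl (P : C → PMF C) (c : C) (x : ℕ → C) (n : ℕ) :
    law P c (cyl x n) = if c = x 0 then ∏ i ∈ Finset.range n, P (x i) (x (i + 1)) else 0 := by
  induction n with
  | zero => simp [law, lawFrom_cyl_zero, Set.indicator_apply]
  | succ n ih =>
    rw [law, lawFrom_cyl_succ, ← law, ih, Finset.prod_range_succ]
    split_ifs <;> simp

/-- Decomposition of the law of a Markov chain by its first step. -/
theorem law_eq_bind (P : C → PMF C) (c : C) :
    law P c = (P c).toMeasure.bind fun c' => (law P c').map (cons c) := by
  classical
  have : Nonempty C := ⟨c⟩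
  have hm : Measurable fun c' => (law P c').map (cons c) := measurable_of_countable _
  have : IsProbabilityMeasure ((P c).toMeasure.bind fun c' => (law P c').map (cons c)) := by
    refine isProbabilityMeasure_bind hm.aemeasurable (ae_of_all _ fun c' => ?_)
    exact Measure.isProbabilityMeasure_map (by fun_prop)
  refine ext_cyl fun x n => ?_
  rw [Measure.bind_apply (measurableSet_cyl _ _) hm.aemeasurable]
  simp_rw [Measure.map_apply (measurable_cons c) (measurableSet_cyl _ _)]
  cases n with
  | zero =>
    rw [law_cyl]
    simp_rw [cons_preimage_cyl_zero]
    by_cases h : c = x 0 <;> simp [h]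
  | succ n =>
    rw [law_cyl]
    simp_rw [cons_preimage_cyl_succ]
    by_cases h : c = x 0
    · simp only [h, true_and, Set.ofPred_mem_eq, if_true, law_cyl]
      rw [lintegral_countable', tsum_eq_single (x 1)]
      · rw [PMF.toMeasure_apply_singleton _ _ (measurableSet_singleton _), Finset.prod_range_succ']
        simp
      · intro b hb
        simp [hb]
    · simp [h]

theorem law_apply (P : C → PMF C) (c : C) {B : Set (ℕ → C)} (hB : MeasurableSet B) :
    law P c B = ∫⁻ c', law P c' (cons c ⁻¹' B) ∂(P c).toMeasure := by
  have hm : Measurable fun c' => (law P c').map (cons c) := measurable_of_countable _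
  rw [law_eq_bind, Measure.bind_apply hB hm.aemeasurable]
  simp_rw [Measure.map_apply (measurable_cons c) hB]

theorem lawFrom_eq_bind (P : C → PMF C) (μ : Measure C) [IsProbabilityMeasure μ] :
    lawFrom P μ = μ.bind (law P) := by
  classical
  have : Nonempty C := nonempty_of_isProbabilityMeasure μ
  have hm : Measurable (law P) := measurable_of_countable _
  have : IsProbabilityMeasure (μ.bind (law P)) :=
    isProbabilityMeasure_bind hm.aemeasurable (ae_of_all _ fun c' => inferInstance)
  refine ext_cyl fun x n => ?_
  rw [Measure.bind_apply (measurableSet_cyl _ _) hm.aemeasurable]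
  induction n with
  | zero =>
    rw [lawFrom_cyl_zero, lintegral_countable', tsum_eq_single (x 0)]
    · simp [law_cyl]
    · intro b hb
      simp [law_cyl, hb]
  | succ n ih =>
    rw [lawFrom_cyl_succ, ih, ← lintegral_mul_const _ (measurable_of_countable _)]
    simp_rw [law, lawFrom_cyl_succ]

end MarkovChain

/-! ### Almost sure events, recurrence and expectations for Markov chains -/

namespace MarkovChain

lemma frequently_succ_iff (p : ℕ → Prop) :
    (∃ᶠ n in atTop, p (n + 1)) ↔ ∃ᶠ n in atTop, p n := by
  conv_rhs => rw [← map_add_atTop_eq_nat 1, frequently_map]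

lemma measurableSet_frequently {Ω : Type*} [MeasurableSpace Ω] {p : ℕ → Ω → Prop}
    (h : ∀ n, MeasurableSet {ω | p n ω}) : MeasurableSet {ω | ∃ᶠ n in atTop, p n ω} := by
  have : {ω | ∃ᶠ n in atTop, p n ω} = ⋂ a, ⋃ b, ⋃ (_ : b ≥ a), {ω | p b ω} := by
    ext ω
    simp [frequently_atTop]
  rw [this]
  exact MeasurableSet.iInter fun a => MeasurableSet.iUnion fun b => MeasurableSet.iUnion fun _ => h b

lemma measurableSet_eval {C : Type*} [MeasurableSpace C] [DiscreteMeasurableSpace C] (n : ℕ)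
    (D : Set C) : MeasurableSet {ω : ℕ → C | ω n ∈ D} :=
  measurable_pi_apply n (MeasurableSet.of_discrete (s := D))

variable {C : Type*} [MeasurableSpace C] [Countable C] [DiscreteMeasurableSpace C]

lemma ae_toMeasure_iff (p : PMF C) (q : C → Prop) :
    (∀ᵐ c ∂p.toMeasure, q c) ↔ ∀ c ∈ p.support, q c := by
  rw [ae_iff_of_countable]
  simp_rw [PMF.toMeasure_apply_singleton _ _ (measurableSet_singleton _), PMF.mem_support_iff]

/-- First-step analysis of almost sure events. -/
lemma ae_law_iff (P : C → PMF C) (c : C) {q : (ℕ → C) → Prop} (hq : MeasurableSet {ω | q ω}) :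
    (∀ᵐ ω ∂law P c, q ω) ↔ ∀ c' ∈ (P c).support, ∀ᵐ ω ∂law P c', q (cons c ω) := by
  rw [ae_iff, law_apply P c (by exact hq.compl), lintegral_eq_zero_iff (measurable_of_countable _)]
  exact ae_toMeasure_iff (P c) fun c' => law P c' (cons c ⁻¹' {ω | ¬ q ω}) = 0

lemma ae_law_zero (P : C → PMF C) (c : C) : ∀ᵐ ω ∂law P c, ω 0 = c := by
  have hm : MeasurableSet {ω : ℕ → C | ω 0 = c} :=
    measurableSet_eval 0 {c}
  rw [ae_law_iff P c hm]
  simp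

lemma measurableSet_eval_succ (n : ℕ) (D : C → Set C) :
    MeasurableSet {ω : ℕ → C | ω (n + 1) ∈ D (ω n)} := by
  have h : Measurable fun ω : ℕ → C => (ω n, ω (n + 1)) :=
    (measurable_pi_apply n).prodMk (measurable_pi_apply (n + 1))
  exact h (MeasurableSet.of_discrete (s := {x : C × C | x.2 ∈ D x.1}))

/-- Almost surely, all transitions of a Markov chain have positive probability. -/
lemma ae_law_support (P : C → PMF C) (c : C) :
    ∀ᵐ ω ∂law P c, ∀ n, ω (n + 1) ∈ (P (ω n)).support := by
  rw [ae_all_iff]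
  intro n
  induction n generalizing c with
  | zero =>
    rw [ae_law_iff P c (measurableSet_eval_succ 0 fun c => (P c).support)]
    intro c' hc'
    filter_upwards [ae_law_zero P c'] with ω hω
    simpa [hω] using hc'
  | succ n ih =>
    rw [ae_law_iff P c (measurableSet_eval_succ (n + 1) fun c => (P c).support)]
    exact fun c' _ => ih c'

/-- If a Markov chain visits `K` infinitely often and moves from each state of `K` into `B` with
probability at least `p > 0`, then it makes infinitely many moves from `K` into `B`. -/
theorem ae_law_frequently (P : C → PMF C) (c : C) (K B : Set C) {p : ENNReal} (hp : p ≠ 0)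
    (hK : ∀ c ∈ K, p ≤ (P c).toMeasure B) :
    ∀ᵐ ω ∂law P c, (∃ᶠ n in atTop, ω n ∈ K) → ∃ᶠ n in atTop, ω n ∈ K ∧ ω (n + 1) ∈ B := by
  -- Failure of the claim means lying in some `bad N`. The case `N = 0` is shown null for all
  -- starting points at once; larger `N` follow by shifting.
  let bad (N : ℕ) : Set (ℕ → C) :=
    {ω | (∃ᶠ n in atTop, ω n ∈ K) ∧ ∀ n ≥ N, ω n ∈ K → ω (n + 1) ∉ B}
  have hmK : MeasurableSet {ω : ℕ → C | ∃ᶠ n in atTop, ω n ∈ K} :=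
    measurableSet_frequently fun n => measurableSet_eval n K
  have hmB (n : ℕ) : MeasurableSet {ω : ℕ → C | ω n ∈ K → ω (n + 1) ∉ B} :=
    measurableSet_eval_succ n fun c => {c' | c ∈ K → c' ∉ B}
  have hm (N : ℕ) : MeasurableSet (bad N) := by
    have : bad N = {ω : ℕ → C | ∃ᶠ n in atTop, ω n ∈ K} ∩
        ⋂ n, ⋂ (_ : n ≥ N), {ω : ℕ → C | ω n ∈ K → ω (n + 1) ∉ B} := by
      ext ω; simp [bad]
    rw [this]
    exact hmK.inter (MeasurableSet.iInter fun n => MeasurableSet.iInter fun _ => hmB n)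
  -- A bound on the time of the first visit to `K` allows an induction that moves the start of the
  -- chain to that visit.
  let early (k : ℕ) : Set (ℕ → C) := bad 0 ∩ {ω | ∃ n ≤ k, ω n ∈ K}
  have hme (k : ℕ) : MeasurableSet (early k) := by
    have : {ω : ℕ → C | ∃ n ≤ k, ω n ∈ K} = ⋃ n, ⋃ (_ : n ≤ k), {ω : ℕ → C | ω n ∈ K} := by
      ext; simp
    refine (hm 0).inter ?_
    rw [this]
    exact MeasurableSet.iUnion fun n => MeasurableSet.iUnion fun _ => measurableSet_eval n K
  set β : ENNReal := ⨆ c, law P c (bad 0) with hβ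
  have hle (c : C) : law P c (bad 0) ≤ β := le_iSup (fun c => law P c (bad 0)) c
  have hfreq (c : C) (ω : ℕ → C) :
      (∃ᶠ n in atTop, cons c ω n ∈ K) ↔ ∃ᶠ n in atTop, ω n ∈ K :=
    (frequently_succ_iff fun n => cons c ω n ∈ K).symm
  have hbad (N : ℕ) (c : C) (ω : ℕ → C) (h : cons c ω ∈ bad (N + 1)) : ω ∈ bad N :=
    ⟨(hfreq c ω).1 h.1, fun n hn => h.2 (n + 1) (by omega)⟩
  have hbad0 (c : C) (ω : ℕ → C) (h : cons c ω ∈ bad 0) : ω ∈ bad 0 :=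
    ⟨(hfreq c ω).1 h.1, fun n _ => h.2 (n + 1) (by omega)⟩
  -- From `K` a bad run must avoid `B` at once, which has probability at most `1 - p`, and the
  -- remaining run is again bad.
  have hstep (c : C) (hc : c ∈ K) : law P c (bad 0) ≤ (1 - p) * β := by
    rw [law_apply P c (hm 0)]
    calc ∫⁻ c', law P c' (cons c ⁻¹' bad 0) ∂(P c).toMeasure
        ≤ ∫⁻ c', (Bᶜ).indicator (fun _ => β) c' ∂(P c).toMeasure := by
          refine lintegral_mono fun c' => ?_
          by_cases hB : c' ∈ B
          · have : law P c' (cons c ⁻¹' bad 0) = 0 := by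
              rw [← nonpos_iff_eq_zero, ← ae_iff.1 (ae_law_zero P c')]
              refine measure_mono fun ω hω h0 => ?_
              exact hω.2 0 le_rfl hc (by simpa [h0] using hB)
            simp [this]
          · rw [Set.indicator_of_mem (by exact hB)]
            exact (measure_mono (hbad0 c)).trans (hle c')
      _ = (P c).toMeasure Bᶜ * β := by
          rw [lintegral_indicator_const MeasurableSet.of_discrete, mul_comm]
      _ ≤ (1 - p) * β := by
          gcongr
          rw [prob_compl_eq_one_sub MeasurableSet.of_discrete]
          exact tsub_le_tsub_left (hK c hc) 1
  have hearly (k : ℕ) (c : C) : law P c (early k) ≤ (1 - p) * β := by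
    induction k generalizing c with
    | zero =>
      by_cases hc : c ∈ K
      · exact (measure_mono Set.inter_subset_left).trans (hstep c hc)
      · have : law P c (early 0) = 0 := by
          rw [← nonpos_iff_eq_zero, ← ae_iff.1 (ae_law_zero P c)]
          refine measure_mono fun ω hω h0 => ?_
          obtain ⟨n, hn, hnK⟩ := hω.2
          obtain rfl : n = 0 := by omega
          exact hc (h0 ▸ hnK)
        simp [this]
    | succ k ih =>
      by_cases hc : c ∈ K
      · exact (measure_mono Set.inter_subset_left).trans (hstep c hc)
      · rw [law_apply P c (hme _)]
        calc ∫⁻ c', law P c' (cons c ⁻¹' early (k + 1)) ∂(P c).toMeasure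
            ≤ ∫⁻ _, (1 - p) * β ∂(P c).toMeasure := by
              refine lintegral_mono fun c' => (measure_mono fun ω hω => ?_).trans (ih c')
              refine ⟨hbad0 c ω hω.1, ?_⟩
              obtain ⟨n | n, hn, hnK⟩ := hω.2
              · exact absurd hnK hc
              · exact ⟨n, by omega, hnK⟩
          _ = (1 - p) * β := by simp
  have hβle : β ≤ (1 - p) * β := by
    refine iSup_le fun c => ?_
    have hU : bad 0 = ⋃ k, early k := by
      ext ω
      simp only [Set.mem_iUnion]
      refine ⟨fun h => ?_, fun ⟨k, h⟩ => h.1⟩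
      obtain ⟨n, hn⟩ := h.1.exists
      exact ⟨n, h, n, le_rfl, hn⟩
    have hmono : Monotone early := fun k l hkl ω hω =>
      ⟨hω.1, by obtain ⟨n, hn, h⟩ := hω.2; exact ⟨n, hn.trans hkl, h⟩⟩
    rw [hU, hmono.measure_iUnion]
    exact iSup_le fun k => hearly k c
  have hβ1 : β ≤ 1 := iSup_le fun c => prob_le_one
  -- Since `β` is finite and `p ≠ 0`, the inequality `β ≤ (1 - p) * β` leaves only `β = 0`.
  have hβ0 : β = 0 := by
    by_contra h
    have h1 : (1 - p) * β < 1 * β := by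
      refine ENNReal.mul_lt_mul_left h (ne_top_of_le_ne_top ENNReal.one_ne_top hβ1) ?_
      exact ENNReal.sub_lt_self ENNReal.one_ne_top one_ne_zero hp
    rw [one_mul] at h1
    exact absurd hβle h1.not_ge
  have hnull (N : ℕ) (c : C) : law P c (bad N) = 0 := by
    induction N generalizing c with
    | zero => exact nonpos_iff_eq_zero.1 ((hle c).trans hβ0.le)
    | succ N ih =>
      rw [law_apply P c (hm _)]
      refine (lintegral_eq_zero_iff (measurable_of_countable _)).2 (ae_of_all _ fun c' => ?_)
      exact measure_mono_null (hbad N c) (ih c')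
  have := measure_iUnion_null fun N => hnull N c
  filter_upwards [measure_eq_zero_iff_ae_notMem.1 this] with ω hω hKω
  by_contra h
  rw [not_frequently, eventually_atTop] at h
  obtain ⟨N, hN⟩ := h
  exact hω (Set.mem_iUnion.2 ⟨N, hKω, fun n hn hnK hnB => hN n hn ⟨hnK, hnB⟩⟩)

/-- A map that intertwines two transition functions maps the laws to each other. -/
theorem law_map {D : Type*} [MeasurableSpace D] [Countable D] [DiscreteMeasurableSpace D]
    (P : C → PMF C) (Q : D → PMF D) (f : C → D) (h : ∀ c, Q (f c) = (P c).map f) (c : C) :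
    (law P c).map (fun ω n => f (ω n)) = law Q (f c) := by
  have : Nonempty D := ⟨f c⟩
  have hf : Measurable f := measurable_of_countable f
  have hm : Measurable fun (ω : ℕ → C) n => f (ω n) :=
    measurable_pi_iff.2 fun n => hf.comp (measurable_pi_apply n)
  have hpr : IsProbabilityMeasure ((law P c).map (fun ω n => f (ω n))) :=
    Measure.isProbabilityMeasure_map hm.aemeasurable
  refine ext_cyl fun x n => ?_
  clear hpr
  rw [Measure.map_apply hm (measurableSet_cyl _ _)]
  induction n generalizing c x with
  | zero =>
    have h1 := law_apply Q (f c) (measurableSet_cyl x 0)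
    have h2 := law_apply P c (hm (measurableSet_cyl x 0))
    rw [h1, h2]
    have : cons c ⁻¹' ((fun (ω : ℕ → C) n => f (ω n)) ⁻¹' cyl x 0) = {_ω | f c = x 0} := by
      ext ω; simp [cyl]
    simp_rw [cons_preimage_cyl_zero, this]
    by_cases h : f c = x 0 <;> simp [h]
  | succ n ih =>
    rw [law_apply Q (f c) (measurableSet_cyl _ _), law_apply P c (hm (measurableSet_cyl _ _)), h,
      ← PMF.toMeasure_map _ _ hf, lintegral_map (measurable_of_countable _) hf]
    refine lintegral_congr fun c' => ?_
    have h1 : cons c ⁻¹' ((fun (ω : ℕ → C) n => f (ω n)) ⁻¹' cyl x (n + 1)) =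
        {ω | f c = x 0 ∧ (fun n => f (ω n)) ∈ cyl (fun i => x (i + 1)) n} := by
      ext ω
      simp only [cyl, Set.mem_preimage, Set.mem_ofPred_eq]
      constructor
      · exact fun h => ⟨h 0 (by omega), fun i hi => h (i + 1) (by omega)⟩
      · rintro ⟨h0, h1⟩ (_ | i) hi
        · exact h0
        · exact h1 i (by omega)
    rw [h1, cons_preimage_cyl_succ]
    by_cases h0 : f c = x 0
    · simp only [h0, true_and]
      exact ih c' (fun i => x (i + 1))
    · simp [h0]

/-- First-step analysis of expectations. -/
theorem integral_law (P : C → PMF C) (c : C) {F : (ℕ → C) → ℝ} (hF : Integrable F (law P c)) :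
    ∫ ω, F ω ∂law P c = ∫ c', ∫ ω, F (cons c ω) ∂law P c' ∂(P c).toMeasure := by
  let κ : Kernel C (ℕ → C) := ⟨fun c' => (law P c').map (cons c), measurable_of_countable _⟩
  have h1 : law P c = κ ∘ₘ (P c).toMeasure := law_eq_bind P c
  rw [h1] at hF ⊢
  have hF' := Measure.ae_integrable_of_integrable_comp hF
  rw [Measure.comp_eq_comp_const_apply] at hF ⊢
  rw [Kernel.integral_comp hF]
  refine integral_congr_ae ?_
  filter_upwards [hF'] with c' hc'
  exact integral_map (measurable_cons c).aemeasurable hc'.1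

theorem integral_lawFrom (P : C → PMF C) (μ : Measure C) [IsProbabilityMeasure μ]
    {F : (ℕ → C) → ℝ} (hF : Integrable F (lawFrom P μ)) :
    ∫ ω, F ω ∂lawFrom P μ = ∫ c, ∫ ω, F ω ∂law P c ∂μ := by
  let κ : Kernel C (ℕ → C) := ⟨law P, measurable_of_countable _⟩
  have h1 : lawFrom P μ = κ ∘ₘ μ := lawFrom_eq_bind P μ
  rw [h1] at hF ⊢
  rw [Measure.comp_eq_comp_const_apply] at hF ⊢
  rw [Kernel.integral_comp hF]
  rfl

lemma ae_lawFrom_iff (P : C → PMF C) (p : PMF C) {q : (ℕ → C) → Prop}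
    (hq : MeasurableSet {ω | q ω}) :
    (∀ᵐ ω ∂lawFrom P p.toMeasure, q ω) ↔ ∀ c ∈ p.support, ∀ᵐ ω ∂law P c, q ω := by
  rw [ae_iff, lawFrom_eq_bind, Measure.bind_apply (by exact hq.compl) (measurable_of_countable _).aemeasurable,
    lintegral_eq_zero_iff (measurable_of_countable _)]
  exact ae_toMeasure_iff p fun c' => law P c' {ω | ¬ q ω} = 0

end MarkovChain

/-! ### Runs of a game: measurability and first-step analysis -/

instance (S A M N : Type*) : DiscreteMeasurableSpace (Config S A M N) := ⟨fun _ => trivial⟩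

instance (S A : Type*) : DiscreteMeasurableSpace (Step S A) := ⟨fun _ => trivial⟩

instance (S A M N : Type*) [Countable S] [Countable A] [Countable M] [Countable N] :
    Countable (Config S A M N) :=
  Function.Injective.countable (f := fun c : Config S A M N => (c.state, c.action, c.memSys, c.memEnv))
    fun ⟨_, _, _, _⟩ ⟨_, _, _, _⟩ h => by simpa using h

instance (S A : Type*) [Finite S] [Finite A] : Finite (Step S A) :=
  Finite.of_injective (fun c : Step S A => (c.state, c.action)) fun ⟨_, _⟩ ⟨_, _⟩ h => by simpa using h

/-- The state and the action of a configuration. -/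
def Config.toStep {S A M N : Type*} (c : Config S A M N) : Step S A := ⟨c.state, c.action⟩

/-- The run underlying a sequence of configurations. -/
def toRun {S A M N : Type*} (ω : ℕ → Config S A M N) (i : ℕ) : Step S A := (ω i).toStep

lemma measurable_toRun {S A M N : Type*} : Measurable (toRun : (ℕ → Config S A M N) → ℕ → Step S A) :=
  measurable_pi_iff.2 fun n => measurable_from_top.comp (measurable_pi_apply n)

lemma toRun_cons {S A M N : Type*} (c : Config S A M N) (ω : ℕ → Config S A M N) :
    toRun (MarkovChain.cons c ω) = MarkovChain.cons c.toStep (toRun ω) := by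
  funext i
  cases i <;> rfl

namespace RabinGame

open MarkovChain

variable {S A : Type*}

instance {G : RabinGame S A} {own : Set S} (σ : G.Strategy own) : Countable σ.Mem := σ.countable_mem

lemma infStates_cons (p : Step S A) (π : ℕ → Step S A) :
    infStates (cons p π) = infStates π := by
  ext s
  exact (frequently_succ_iff fun i => (cons p π i).state = s).symm

lemma cons_mem_winningRuns (G : RabinGame S A) (p : Step S A) (π : ℕ → Step S A) :
    cons p π ∈ G.winningRuns ↔ π ∈ G.winningRuns := by
  simp [winningRuns, infStates_cons]

lemma measurableSet_winningRuns [Finite S] (G : RabinGame S A) : MeasurableSet G.winningRuns := by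
  have hs (s : S) : MeasurableSet {π : ℕ → Step S A | s ∈ infStates π} :=
    measurableSet_frequently fun n => measurableSet_eval n {p : Step S A | p.state = s}
  have : G.winningRuns = ⋃ i, (⋃ s ∈ G.F i, {π | s ∈ infStates π}) ∩
      ⋂ s ∈ G.E i, {π | s ∈ infStates π}ᶜ := by
    ext π
    simp only [winningRuns, Set.mem_ofPred_eq, Set.mem_iUnion, Set.mem_inter_iff, Set.mem_iInter,
      Set.mem_compl_iff, Set.Nonempty, Set.eq_empty_iff_forall_notMem]
    refine exists_congr fun i => and_congr ⟨fun ⟨s, h⟩ => ⟨s, h.2, h.1⟩, fun ⟨s, h1, h2⟩ => ⟨s, h2, h1⟩⟩ ?_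
    exact forall_congr' fun s => ⟨fun h hE hI => h ⟨hI, hE⟩, fun h hh => h hh.2 hh.1⟩
  rw [this]
  have := Finite.to_countable (α := S)
  exact MeasurableSet.iUnion fun i =>
    (MeasurableSet.biUnion (Set.to_countable _) fun s _ => hs s).inter
      (MeasurableSet.biInter (Set.to_countable _) fun s _ => (hs s).compl)

variable (G : RabinGame S A) (σ : G.SysStrategy) (τ : G.EnvStrategy)

lemma mem_support_enter {s : S} {m : σ.Mem} {n : τ.Mem} {c : Config S A σ.Mem τ.Mem} :
    c ∈ (G.enter σ τ s m n).support ↔ ∃ a ∈ (G.actionDist σ τ s m n).support, c = ⟨s, a, m, n⟩ := by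
  rw [enter, PMF.mem_support_map_iff]
  simp only [eq_comm]

lemma mem_support_stepDist {c c' : Config S A σ.Mem τ.Mem} :
    c' ∈ (G.stepDist σ τ c).support ↔ ∃ s ∈ (G.trans c.state c.action).support,
      c' ∈ (G.enter σ τ s (σ.update c.state c.memSys) (τ.update c.state c.memEnv)).support := by
  rw [stepDist, PMF.mem_support_bind_iff]

section Countable

variable [Countable S] [Countable A]

/-- The law of the sequence of configurations from a state and a pair of memory states. -/
def entryLaw (s : S) (m : σ.Mem) (n : τ.Mem) : Measure (ℕ → Config S A σ.Mem τ.Mem) :=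
  lawFrom (G.stepDist σ τ) (G.enter σ τ s m n).toMeasure

instance (s : S) (m : σ.Mem) (n : τ.Mem) : IsProbabilityMeasure (G.entryLaw σ τ s m n) := by
  unfold entryLaw; infer_instance

lemma runLaw_eq (s : S) :
    G.runLaw σ τ s = (G.entryLaw σ τ s σ.memInit τ.memInit).map toRun := rfl

variable {G σ τ}

/-- First-step analysis of almost sure events in a game. -/
lemma ae_entryLaw_iff {s : S} {m : σ.Mem} {n : τ.Mem} {q : (ℕ → Config S A σ.Mem τ.Mem) → Prop}
    (hq : MeasurableSet {ω | q ω}) :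
    (∀ᵐ ω ∂G.entryLaw σ τ s m n, q ω) ↔
      ∀ a ∈ (G.actionDist σ τ s m n).support, ∀ s' ∈ (G.trans s a).support,
        ∀ᵐ ω ∂G.entryLaw σ τ s' (σ.update s m) (τ.update s n), q (cons ⟨s, a, m, n⟩ ω) := by
  have hq' (c) : MeasurableSet {ω : ℕ → Config S A σ.Mem τ.Mem | q (cons c ω)} :=
    measurable_cons c hq
  rw [entryLaw, ae_lawFrom_iff _ _ hq]
  simp_rw [mem_support_enter]
  constructor
  · intro h a ha s' hs'
    rw [entryLaw, ae_lawFrom_iff _ _ (hq' _)]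
    intro c hc
    exact (ae_law_iff _ _ hq).1 (h _ ⟨a, ha, rfl⟩) c
      ((mem_support_stepDist ..).2 ⟨s', hs', hc⟩)
  · rintro h c ⟨a, ha, rfl⟩
    rw [ae_law_iff _ _ hq]
    intro c hc
    obtain ⟨s', hs', hc⟩ := (mem_support_stepDist ..).1 hc
    have := h a ha s' hs'
    rw [entryLaw, ae_lawFrom_iff _ _ (hq' _)] at this
    exact this c hc

/-- The event need not be measurable: the intersection of the measurable hulls of its complement,
one for each of the countably many starting configurations, is a single measurable set that is null
for all laws. -/
lemma ae_entryLaw_of_law {s : S} {m : σ.Mem} {n : τ.Mem} {q : (ℕ → Config S A σ.Mem τ.Mem) → Prop}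
    (h : ∀ c, ∀ᵐ ω ∂law (G.stepDist σ τ) c, q ω) : ∀ᵐ ω ∂G.entryLaw σ τ s m n, q ω := by
  obtain ⟨t, hqt, ht, ht0⟩ : ∃ t, {ω | ¬ q ω} ⊆ t ∧ MeasurableSet t ∧
      ∀ c, law (G.stepDist σ τ) c t = 0 := by
    refine ⟨⋂ c, toMeasurable (law (G.stepDist σ τ) c) {ω | ¬ q ω}, ?_, ?_, ?_⟩
    · exact Set.subset_iInter fun c => subset_toMeasurable _ _
    · exact MeasurableSet.iInter fun c => measurableSet_toMeasurable _ _
    · intro c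
      refine measure_mono_null (Set.iInter_subset _ c) ?_
      rw [measure_toMeasurable]
      exact h c
  have : ∀ᵐ ω ∂G.entryLaw σ τ s m n, ω ∉ t := by
    rw [entryLaw, ae_lawFrom_iff _ _ ht.compl]
    exact fun c _ => measure_eq_zero_iff_ae_notMem.1 (ht0 c)
  filter_upwards [this] with ω hω
  by_contra hc
  exact hω (hqt hc)

lemma ae_entryLaw_zero (s : S) (m : σ.Mem) (n : τ.Mem) :
    ∀ᵐ ω ∂G.entryLaw σ τ s m n, ω 0 ∈ (G.enter σ τ s m n).support := by
  rw [entryLaw, ae_lawFrom_iff _ _ (measurableSet_eval 0 _)]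
  intro c hc
  filter_upwards [ae_law_zero (G.stepDist σ τ) c] with ω hω
  rwa [hω]

lemma ae_entryLaw_support (s : S) (m : σ.Mem) (n : τ.Mem) :
    ∀ᵐ ω ∂G.entryLaw σ τ s m n, ∀ i, ω (i + 1) ∈ (G.stepDist σ τ (ω i)).support :=
  ae_entryLaw_of_law fun c => ae_law_support _ c

end Countable

variable {G σ τ}

lemma measurableSet_toRun_winning [Finite S] :
    MeasurableSet {ω : ℕ → Config S A σ.Mem τ.Mem | toRun ω ∈ G.winningRuns} :=
  measurable_toRun G.measurableSet_winningRuns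

variable [Finite S] [Finite A]

/-- The runs of a pair of strategies from given memory states are almost surely winning. -/
def WinsEntry (G : RabinGame S A) (σ : G.SysStrategy) (τ : G.EnvStrategy) (s : S) (m : σ.Mem)
    (n : τ.Mem) : Prop :=
  ∀ᵐ ω ∂G.entryLaw σ τ s m n, toRun ω ∈ G.winningRuns

lemma winsFrom_iff {s : S} :
    G.WinsFrom σ s ↔ ∀ τ : G.EnvStrategy, G.WinsEntry σ τ s σ.memInit τ.memInit := by
  refine forall_congr' fun τ => ?_
  rw [runLaw_eq, Measure.map_apply measurable_toRun G.measurableSet_winningRuns, WinsEntry]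
  exact (mem_ae_iff_prob_eq_one (measurable_toRun G.measurableSet_winningRuns)).symm

/-- The Rabin condition is independent of finite prefixes, so the first step can be dropped from the
run. -/
lemma winsEntry_iff {s : S} {m : σ.Mem} {n : τ.Mem} :
    G.WinsEntry σ τ s m n ↔
      ∀ a ∈ (G.actionDist σ τ s m n).support, ∀ s' ∈ (G.trans s a).support,
        G.WinsEntry σ τ s' (σ.update s m) (τ.update s n) := by
  rw [WinsEntry, ae_entryLaw_iff measurableSet_toRun_winning]
  simp_rw [toRun_cons, cons_mem_winningRuns, WinsEntry]

/-- The environment strategy `τ` with another initial memory state. -/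
def Strategy.withInit {own : Set S} (τ : G.Strategy own) (n : τ.Mem) : G.Strategy own :=
  { τ with memInit := n }

/-- Winning quantifies over all environment strategies, including `τ` restarted in any of its memory
states. -/
lemma WinsFrom.winsEntry {s : S} (h : G.WinsFrom σ s) (τ : G.EnvStrategy) (n : τ.Mem) :
    G.WinsEntry σ τ s σ.memInit n :=
  winsFrom_iff.1 h (τ.withInit n)

end RabinGame

/-! ### End components and almost-sure winning of memoryless strategies -/

namespace RabinGame

open MarkovChain

lemma exists_frequently_of_finite {ι : Type*} [Finite ι] {p : ι → ℕ → Prop}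
    (h : ∃ᶠ i in atTop, ∃ x, p x i) : ∃ x, ∃ᶠ i in atTop, p x i := by
  by_contra hc
  push Not at hc
  refine h ?_
  filter_upwards [eventually_all.2 hc] with i hi
  rintro ⟨x, hx⟩
  exact hi x hx

variable {S A : Type*}

/-- The actions available at `s`, restricted at system states to those that the memoryless
strategy `σ` plays with positive probability. -/
def playable {G : RabinGame S A} (σ : G.SysStrategy) (s : S) : Set A :=
  {a | a ∈ G.avail s ∧ ∀ h : s ∈ G.sys, a ∈ (σ.choose ⟨s, h⟩ σ.memInit).support}

variable {G : RabinGame S A} {σ : G.SysStrategy} {τ : G.EnvStrategy}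

lemma actionDist_sys {s : S} (h : s ∈ G.sys) (m : σ.Mem) (n : τ.Mem) :
    G.actionDist σ τ s m n = σ.choose ⟨s, h⟩ m := by simp [actionDist, h]

lemma actionDist_env {s : S} (h : s ∉ G.sys) (m : σ.Mem) (n : τ.Mem) :
    G.actionDist σ τ s m n = τ.choose ⟨s, h⟩ n := by simp [actionDist, h]

lemma Strategy.Memoryless.eq {own : Set S} {σ : G.Strategy own} (hσ : σ.Memoryless)
    (m : σ.Mem) : m = σ.memInit := by
  obtain ⟨_⟩ := hσ
  exact Subsingleton.elim _ _

lemma support_actionDist_subset (hσ : σ.Memoryless) (s : S) (m : σ.Mem) (n : τ.Mem) :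
    (G.actionDist σ τ s m n).support ⊆ playable σ s := by
  intro a ha
  by_cases h : s ∈ G.sys
  · rw [actionDist_sys h] at ha
    exact ⟨σ.choose_avail _ _ a ha, fun _ => by rwa [hσ.eq m] at ha⟩
  · rw [actionDist_env h] at ha
    exact ⟨τ.choose_avail _ _ a ha, fun h' => absurd h' h⟩

section Recurrence

variable [Finite S] [Finite A]

/-- After infinitely many visits to `p`, every action played with a probability bounded below
at a possible successor state is played infinitely often directly after `p`. -/
lemma ae_frequently_step (s : S) (m : σ.Mem) (n : τ.Mem) (p p' : Step S A)
    (hp' : p'.state ∈ (G.trans p.state p.action).support) {r : ENNReal} (hr : r ≠ 0)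
    (hact : ∀ m n, r ≤ G.actionDist σ τ p'.state m n p'.action) :
    ∀ᵐ ω ∂G.entryLaw σ τ s m n, (∃ᶠ i in atTop, toRun ω i = p) →
      ∃ᶠ i in atTop, toRun ω i = p ∧ toRun ω (i + 1) = p' := by
  refine ae_entryLaw_of_law fun c => ?_
  have ht : G.trans p.state p.action p'.state ≠ 0 := (PMF.mem_support_iff _ _).1 hp'
  refine ae_law_frequently _ c {c | c.toStep = p} {c | c.toStep = p'}
    (p := G.trans p.state p.action p'.state * r) (mul_ne_zero ht hr) ?_
  rintro c rfl
  obtain ⟨s', a'⟩ := p'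
  set m' := σ.update c.state c.memSys
  set n' := τ.update c.state c.memEnv
  calc G.trans c.state c.action s' * r
      ≤ G.trans c.state c.action s' * G.enter σ τ s' m' n' ⟨s', a', m', n'⟩ := by
        gcongr
        refine (hact m' n').trans ?_
        rw [enter, PMF.map_apply]
        refine le_trans ?_ (ENNReal.le_tsum a')
        simp
    _ ≤ G.stepDist σ τ c ⟨s', a', m', n'⟩ := by
        rw [stepDist, PMF.bind_apply]
        exact ENNReal.le_tsum (f := fun x => G.trans c.state c.action x *
          G.enter σ τ x m' n' ⟨s', a', m', n'⟩) s'
    _ ≤ (G.stepDist σ τ c).toMeasure {c | c.toStep = ⟨s', a'⟩} := by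
        rw [← PMF.toMeasure_apply_singleton _ _ (measurableSet_singleton _)]
        exact measure_mono (by rintro _ rfl; rfl)

/-- Whatever the memory states are, the state component of `stepDist` has the law given by `trans`,
so the probability of moving to `s'` is constant over visits to `p`. -/
lemma ae_frequently_state (s : S) (m : σ.Mem) (n : τ.Mem) (p : Step S A) (s' : S)
    (hs' : s' ∈ (G.trans p.state p.action).support) :
    ∀ᵐ ω ∂G.entryLaw σ τ s m n, (∃ᶠ i in atTop, toRun ω i = p) →
      ∃ᶠ i in atTop, toRun ω i = p ∧ (toRun ω (i + 1)).state = s' := by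
  refine ae_entryLaw_of_law fun c => ?_
  have ht : G.trans p.state p.action s' ≠ 0 := (PMF.mem_support_iff _ _).1 hs'
  refine ae_law_frequently _ c {c | c.toStep = p} {c | c.toStep.state = s'}
    (p := G.trans p.state p.action s') ht ?_
  rintro c rfl
  have h1 : (G.stepDist σ τ c).map (fun c => c.toStep.state) = G.trans c.state c.action := by
    rw [stepDist, PMF.map_bind]
    conv_rhs => rw [← PMF.bind_pure (G.trans c.state c.action)]
    congr 1
    funext s'
    rw [enter, PMF.map_comp]
    exact PMF.map_const _ _
  have h2 : (G.stepDist σ τ c).toMeasure {c | c.toStep.state = s'} =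
      G.trans c.state c.action s' := by
    let _ : MeasurableSpace S := ⊤
    rw [← h1, ← PMF.toMeasure_apply_singleton _ _ (measurableSet_singleton _),
      PMF.toMeasure_map_apply _ _ _ measurable_from_top (measurableSet_singleton _)]
    rfl
  exact h2.ge

end Recurrence

/-- The properties of a run that hold almost surely when the system plays a memoryless
strategy `σ`. -/
structure Typical (G : RabinGame S A) (σ : G.SysStrategy) (s : S) (π : ℕ → Step S A) : Prop where
  start : (π 0).state = s
  playable : ∀ i, (π i).action ∈ playable σ (π i).state
  trans : ∀ i, (π (i + 1)).state ∈ (G.trans (π i).state (π i).action).support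
  state : ∀ p s', s' ∈ (G.trans p.state p.action).support → (∃ᶠ i in atTop, π i = p) →
    ∃ᶠ i in atTop, π i = p ∧ (π (i + 1)).state = s'
  step : ∀ (p p' : Step S A) (h : p'.state ∈ G.sys),
    p'.state ∈ (G.trans p.state p.action).support →
    p'.action ∈ (σ.choose ⟨p'.state, h⟩ σ.memInit).support → (∃ᶠ i in atTop, π i = p) →
    ∃ᶠ i in atTop, π i = p ∧ π (i + 1) = p'

/-- A memoryless system plays each of its actions with a fixed positive probability. An environment
with memory admits no such lower bound, which is why `Typical.step` speaks only of system states. -/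
lemma ae_typical [Finite S] [Finite A] (hσ : σ.Memoryless) (s : S) (m : σ.Mem) (n : τ.Mem) :
    ∀ᵐ ω ∂G.entryLaw σ τ s m n, Typical G σ s (toRun ω) := by
  have h1 : ∀ᵐ ω ∂G.entryLaw σ τ s m n, ∀ p s', s' ∈ (G.trans p.state p.action).support →
      (∃ᶠ i in atTop, toRun ω i = p) →
      ∃ᶠ i in atTop, toRun ω i = p ∧ (toRun ω (i + 1)).state = s' := by
    rw [ae_all_iff]; intro p
    rw [ae_all_iff]; intro s'
    rw [ae_all_iff]; intro hs'
    exact ae_frequently_state s m n p s' hs'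
  have h2 : ∀ᵐ ω ∂G.entryLaw σ τ s m n, ∀ (p p' : Step S A) (h : p'.state ∈ G.sys),
      p'.state ∈ (G.trans p.state p.action).support →
      p'.action ∈ (σ.choose ⟨p'.state, h⟩ σ.memInit).support →
      (∃ᶠ i in atTop, toRun ω i = p) →
      ∃ᶠ i in atTop, toRun ω i = p ∧ toRun ω (i + 1) = p' := by
    rw [ae_all_iff]; intro p
    rw [ae_all_iff]; intro p'
    rw [ae_all_iff]; intro h
    rw [ae_all_iff]; intro hs'
    rw [ae_all_iff]; intro ha
    refine ae_frequently_step s m n p p' hs' ((PMF.mem_support_iff _ _).1 ha) fun m n => ?_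
    rw [actionDist_sys h, hσ.eq m]
  filter_upwards [h1, h2, ae_entryLaw_zero s m n, ae_entryLaw_support s m n] with ω h1 h2 h3 h4
  have hent {s m n} {c : Config S A σ.Mem τ.Mem} (h : c ∈ (G.enter σ τ s m n).support) :
      c.state = s ∧ c.action ∈ playable σ c.state := by
    obtain ⟨a, ha, rfl⟩ := (mem_support_enter ..).1 h
    exact ⟨rfl, support_actionDist_subset hσ _ _ _ ha⟩
  refine ⟨(hent h3).1, ?_, ?_, h1, h2⟩
  · rintro (_ | i)
    · exact (hent h3).2
    · obtain ⟨s', -, h⟩ := (mem_support_stepDist ..).1 (h4 i)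
      exact (hent h).2
  · intro i
    obtain ⟨s', hs', h⟩ := (mem_support_stepDist ..).1 (h4 i)
    have := (hent h).1
    change (ω (i + 1)).state ∈ _
    rw [this]
    exact hs'

/-- An end component of the Markov decision process that results from a memoryless system
strategy: a set `H` of states and the sets `B s` of actions used at the states `s ∈ H`. -/
structure IsEndComponent (G : RabinGame S A) (σ : G.SysStrategy) (H : Set S) (B : S → Set A) :
    Prop where
  nonempty : H.Nonempty
  action_nonempty : ∀ s ∈ H, (B s).Nonempty
  subset : ∀ s ∈ H, B s ⊆ playable σ s
  sys : ∀ s ∈ H, s ∈ G.sys → playable σ s ⊆ B s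
  closed : ∀ s ∈ H, ∀ a ∈ B s, ∀ s' ∈ (G.trans s a).support, s' ∈ H
  connected : ∀ s ∈ H, ∀ s' ∈ H,
    Relation.ReflTransGen (fun s s' => ∃ a ∈ B s, s' ∈ (G.trans s a).support) s s'

section

variable {π : ℕ → Step S A}

lemma infStates_nonempty [Finite S] (π : ℕ → Step S A) : (infStates π).Nonempty :=
  exists_frequently_of_finite (p := fun s i => (π i).state = s)
    (Eventually.frequently (Eventually.of_forall fun _ => ⟨_, rfl⟩))

lemma exists_frequently_action [Finite A] {s : S} (hs : s ∈ infStates π) :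
    ∃ a, ∃ᶠ i in atTop, π i = ⟨s, a⟩ := by
  refine exists_frequently_of_finite (Frequently.mono hs fun i hi => ⟨(π i).action, ?_⟩)
  rw [← hi]

/-- The states and actions that occur infinitely often in a typical run form an end component. -/
lemma Typical.isEndComponent [Finite S] [Finite A] {s₀ : S} (hπ : Typical G σ s₀ π) :
    IsEndComponent G σ (infStates π) (fun s => {a | ∃ᶠ i in atTop, π i = ⟨s, a⟩}) where
  nonempty := infStates_nonempty π
  action_nonempty s hs := exists_frequently_action hs
  subset s _ a ha := by
    obtain ⟨i, hi⟩ := Frequently.exists ha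
    simpa [hi] using hπ.playable i
  sys s hs h a ha := by
    -- By pigeonhole one entry `p` directly precedes `s` infinitely often; after it, each action of
    -- the system at `s` recurs.
    have h1 : ∃ᶠ i in atTop, ∃ p, π i = p ∧ (π (i + 1)).state = s :=
      ((frequently_succ_iff fun i => (π i).state = s).2 hs).mono fun i hi => ⟨_, rfl, hi⟩
    obtain ⟨p, hp⟩ := exists_frequently_of_finite h1
    obtain ⟨i, rfl, hi⟩ := hp.exists
    have h2 := hπ.step (π i) ⟨s, a⟩ h (hi ▸ hπ.trans i) (ha.2 h) (hp.mono fun i hi => hi.1)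
    exact (frequently_succ_iff fun i => π i = ⟨s, a⟩).1 (h2.mono fun i hi => hi.2)
  closed s _ a ha s' hs' := by
    have := hπ.state ⟨s, a⟩ s' hs' ha
    exact (frequently_succ_iff fun i => (π i).state = s').1 (this.mono fun i hi => hi.2)
  connected s hs s' hs' := by
    -- From some time on, only recurring entries occur. The stretch of the run between late visits
    -- to `s` and `s'` is therefore a path through recurring actions.
    have h1 : ∀ᶠ i in atTop, ∃ᶠ j in atTop, π j = π i := by
      have : ∀ᶠ i in atTop, ∀ p : Step S A, (¬ ∃ᶠ j in atTop, π j = p) → π i ≠ p := by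
        refine eventually_all.2 fun p => ?_
        by_cases hp : ∃ᶠ j in atTop, π j = p
        · exact Eventually.of_forall fun i h => absurd hp h
        · filter_upwards [not_frequently.1 hp] with i hi _ using hi
      filter_upwards [this] with i hi
      by_contra h
      exact hi _ h rfl
    obtain ⟨N, hN⟩ := eventually_atTop.1 h1
    obtain ⟨i, hi, rfl⟩ := frequently_atTop.1 hs N
    obtain ⟨j, hj, rfl⟩ := frequently_atTop.1 hs' i
    clear hs'
    induction j, hj using Nat.le_induction with
    | base => exact .refl
    | succ j hj ih => exact ih.tail ⟨(π j).action, hN j (hi.trans hj), hπ.trans j⟩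

end


lemma IsEndComponent.congr {σ' : G.SysStrategy} {H : Set S} {B : S → Set A}
    (h : IsEndComponent G σ H B) (hσ : ∀ s, playable σ s = playable σ' s) :
    IsEndComponent G σ' H B where
  nonempty := h.nonempty
  action_nonempty := h.action_nonempty
  subset s hs := hσ s ▸ h.subset s hs
  sys s hs hsys := hσ s ▸ h.sys s hs hsys
  closed := h.closed
  connected := h.connected

/-- The memoryless strategy that plays the distributions `p`. -/
def memorylessStrategy (G : RabinGame S A) (own : Set S) (p : S → PMF A)
    (hp : ∀ s, (p s).support ⊆ G.avail s) : G.Strategy own where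
  Mem := Unit
  countable_mem := inferInstance
  memInit := ()
  choose s _ := p s
  choose_avail s _ _ ha := hp s ha
  update _ _ := ()

lemma memorylessStrategy_memoryless {own : Set S} {p : S → PMF A}
    {hp : ∀ s, (p s).support ⊆ G.avail s} : (G.memorylessStrategy own p hp).Memoryless :=
  ⟨inferInstanceAs (Unique Unit)⟩

lemma playable_nonempty (σ : G.SysStrategy) (s : S) : (playable σ s).Nonempty := by
  by_cases h : s ∈ G.sys
  · obtain ⟨a, ha⟩ := (σ.choose ⟨s, h⟩ σ.memInit).support_nonempty
    exact ⟨a, σ.choose_avail _ _ _ ha, fun _ => ha⟩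
  · obtain ⟨a, ha⟩ := G.avail_nonempty s
    exact ⟨a, ha, fun h' => absurd h' h⟩

/-- If both players randomize over the actions of an end component, then almost surely exactly
the states of the end component are visited infinitely often. -/
lemma IsEndComponent.ae_infStates_eq [Finite S] [Finite A] {H : Set S} {B : S → Set A}
    (h : IsEndComponent G σ H B) (hσ : σ.Memoryless) (hτ : τ.Memoryless)
    (hB : ∀ s ∈ H, ∀ m n, (G.actionDist σ τ s m n).support = B s) {s : S} (hs : s ∈ H)
    (m : σ.Mem) (n : τ.Mem) :
    ∀ᵐ ω ∂G.entryLaw σ τ s m n, infStates (toRun ω) = H := by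
  have h1 : ∀ᵐ ω ∂G.entryLaw σ τ s m n, ∀ (p p' : Step S A),
      p'.state ∈ (G.trans p.state p.action).support → p'.state ∈ H → p'.action ∈ B p'.state →
      (∃ᶠ i in atTop, toRun ω i = p) →
      ∃ᶠ i in atTop, toRun ω i = p ∧ toRun ω (i + 1) = p' := by
    rw [ae_all_iff]; intro p
    rw [ae_all_iff]; intro p'
    rw [ae_all_iff]; intro hs'
    rw [ae_all_iff]; intro hH
    rw [ae_all_iff]; intro ha
    rw [← hB _ hH σ.memInit τ.memInit] at ha
    refine ae_frequently_step s m n p p' hs' ((PMF.mem_support_iff _ _).1 ha) fun m n => ?_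
    rw [hσ.eq m, hτ.eq n]
  filter_upwards [h1, ae_entryLaw_zero s m n, ae_entryLaw_support s m n] with ω h1 h3 h4
  have hent {s m n} {c : Config S A σ.Mem τ.Mem} (h : c ∈ (G.enter σ τ s m n).support)
      (hs : s ∈ H) : c.state ∈ H ∧ c.action ∈ B c.state := by
    obtain ⟨a, ha, rfl⟩ := (mem_support_enter ..).1 h
    exact ⟨hs, hB s hs _ _ ▸ ha⟩
  have hin (i : ℕ) : (ω i).state ∈ H ∧ (ω i).action ∈ B (ω i).state := by
    induction i with
    | zero => exact hent h3 hs
    | succ i ih =>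
      obtain ⟨s', hs', hc⟩ := (mem_support_stepDist ..).1 (h4 i)
      exact hent hc (h.closed _ ih.1 _ ih.2 _ hs')
  have hsub : infStates (toRun ω) ⊆ H := by
    intro s' hs'
    obtain ⟨i, rfl⟩ := Frequently.exists hs'
    exact (hin i).1
  refine hsub.antisymm fun t ht => ?_
  have hnext {p : Step S A} (hp : ∃ᶠ i in atTop, toRun ω i = p) {s' : S}
      (hs' : s' ∈ (G.trans p.state p.action).support) (hH : s' ∈ H) :
      ∀ a ∈ B s', ∃ᶠ i in atTop, toRun ω i = ⟨s', a⟩ := by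
    intro a ha
    have := h1 p ⟨s', a⟩ hs' hH ha hp
    exact (frequently_succ_iff fun i => toRun ω i = ⟨s', a⟩).1 (this.mono fun i hi => hi.2)
  -- Some entry recurs. Every action of `B` at a successor of it then recurs, and connectedness
  -- carries this to `t`.
  obtain ⟨s₁, hs₁⟩ := infStates_nonempty (toRun ω)
  obtain ⟨a₁, ha₁⟩ := exists_frequently_action hs₁
  obtain ⟨s₂, hs₂⟩ := (G.trans s₁ a₁).support_nonempty
  have hH₂ : s₂ ∈ H := by
    obtain ⟨i, hi⟩ := ha₁.exists
    have := h.closed _ (hin i).1 _ (hin i).2 s₂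
    change (ω i).toStep = _ at hi
    rw [Config.toStep, Step.mk.injEq] at hi
    rw [hi.1, hi.2] at this
    exact this hs₂
  have key : t ∈ H ∧ ∀ a ∈ B t, ∃ᶠ i in atTop, toRun ω i = ⟨t, a⟩ := by
    refine Relation.ReflTransGen.head_induction_on
      (motive := fun s' _ => (s' ∈ H ∧ ∀ a ∈ B s', ∃ᶠ i in atTop, toRun ω i = ⟨s', a⟩) →
        (t ∈ H ∧ ∀ a ∈ B t, ∃ᶠ i in atTop, toRun ω i = ⟨t, a⟩))
      (h.connected s₂ hH₂ t ht) id ?_ ⟨hH₂, hnext ha₁ hs₂ hH₂⟩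
    rintro x y ⟨a, ha, hy⟩ - ih ⟨hx, hxa⟩
    have hyH := h.closed x hx a ha y hy
    exact ih ⟨hyH, hnext (hxa a ha) hy hyH⟩
  obtain ⟨a, ha⟩ := h.action_nonempty t ht
  exact (key.2 a ha).mono fun i hi => by rw [hi]

/-- If an end component with a losing set of states is reachable, then the memoryless strategy
is not almost surely winning. -/
lemma IsEndComponent.not_winsFrom [Finite S] [Finite A] {H : Set S} {B : S → Set A}
    (h : IsEndComponent G σ H B) (hσ : σ.Memoryless)
    (hlose : ∀ π ∈ G.winningRuns, infStates π ≠ H) {s t : S} (ht : t ∈ H)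
    (hst : Relation.ReflTransGen
      (fun s s' => ∃ a ∈ playable σ s, s' ∈ (G.trans s a).support) s t) :
    ¬ G.WinsFrom σ s := by
  classical
  -- The environment randomizes over the component inside `H` and over all available actions
  -- outside, so it reaches `H` with positive probability. At system states of `H` the two choices
  -- agree, by the field `sys`.
  let D (s : S) : Set A := if s ∈ H then B s else playable σ s
  have hDsub (s : S) : D s ⊆ playable σ s := by
    by_cases hs : s ∈ H
    · simpa [D, hs] using h.subset s hs
    · simp [D, hs]
  have hD (s : S) : (D s).Nonempty := by
    by_cases hs : s ∈ H
    · simpa [D, hs] using h.action_nonempty s hs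
    · simpa [D, hs] using playable_nonempty σ s
  let p (s : S) : PMF A :=
    PMF.uniformOfFinset (Set.toFinite (D s)).toFinset (by simpa using hD s)
  have hp (s : S) : (p s).support = D s := by simp [p]
  let τ : G.EnvStrategy :=
    G.memorylessStrategy G.sysᶜ p fun s _ ha => (hDsub s (hp s ▸ ha)).1
  have hsupp (s : S) (m : σ.Mem) (n : τ.Mem) : (G.actionDist σ τ s m n).support = D s := by
    by_cases hs : s ∈ G.sys
    · rw [actionDist_sys hs, hσ.eq m]
      have h1 : (σ.choose ⟨s, hs⟩ σ.memInit).support = playable σ s := by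
        ext a
        exact ⟨fun ha => ⟨σ.choose_avail _ _ _ ha, fun _ => ha⟩, fun ha => ha.2 hs⟩
      rw [h1]
      refine subset_antisymm ?_ (hDsub s)
      by_cases hH : s ∈ H
      · simpa [D, hH] using h.sys s hH hs
      · simp [D, hH]
    · rw [actionDist_env hs]
      exact hp s
  have hmain : ∀ m n, ¬ G.WinsEntry σ τ s m n := by
    -- Losing is propagated backwards along the path to `t`. A state of the path that already lies
    -- in `H` loses directly, since play may not follow the path from there.
    refine Relation.ReflTransGen.head_induction_on
      (motive := fun s _ => ∀ m n, ¬ G.WinsEntry σ τ s m n) hst ?_ ?_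
    · intro m n hw
      have h1 := h.ae_infStates_eq (τ := τ) hσ memorylessStrategy_memoryless
        (fun s hs m n => by rw [hsupp]; simp [D, hs]) ht m n
      obtain ⟨ω, hω1, hω2⟩ := (h1.and hw).exists
      exact hlose _ hω2 hω1
    · rintro x y ⟨a, ha, hy⟩ - ih m n hw
      by_cases hx : x ∈ H
      · have h1 := h.ae_infStates_eq (τ := τ) hσ memorylessStrategy_memoryless
          (fun s hs m n => by rw [hsupp]; simp [D, hs]) hx m n
        obtain ⟨ω, hω1, hω2⟩ := (h1.and hw).exists
        exact hlose _ hω2 hω1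
      · refine ih _ _ (winsEntry_iff.1 hw a ?_ y hy)
        rw [hsupp]
        simpa [D, hx] using ha
  exact fun hw => hmain _ _ (winsFrom_iff.1 hw τ)

/-- Whether a memoryless strategy wins almost surely depends only on the actions that it plays
with positive probability. -/
theorem WinsFrom.congr_support [Finite S] [Finite A] {σ σ' : G.SysStrategy} (hσ : σ.Memoryless)
    (hσ' : σ'.Memoryless)
    (hsupp : ∀ s, (σ'.choose s σ'.memInit).support = (σ.choose s σ.memInit).support) {s : S}
    (hw : G.WinsFrom σ s) : G.WinsFrom σ' s := by
  have hplay (s : S) : playable σ' s = playable σ s := by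
    ext a
    simp [playable, hsupp]
  rw [winsFrom_iff]
  intro τ
  by_contra hlose
  have h1 : ∃ᵐ ω ∂G.entryLaw σ' τ s σ'.memInit τ.memInit, ¬ toRun ω ∈ G.winningRuns :=
    not_eventually.1 hlose
  -- A single run that is both losing and typical for `σ'` suffices. Its end component is also one
  -- for `σ`, and its prefix is a path by which `σ` can reach it.
  obtain ⟨ω, hω, ht⟩ := (h1.and_eventually (ae_typical hσ' s _ _)).exists
  obtain ⟨t, htH⟩ := infStates_nonempty (toRun ω)
  refine (ht.isEndComponent.congr hplay).not_winsFrom hσ ?_ htH ?_ hw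
  · rintro π hπ heq
    exact hω (by simpa [winningRuns, heq] using hπ)
  · obtain ⟨i, rfl⟩ := Frequently.exists htH
    clear htH
    induction i with
    | zero => rw [ht.start]
    | succ i ih => exact ih.tail ⟨_, hplay _ ▸ ht.playable i, ht.trans i⟩

end RabinGame

/-! ### Finite averages, discounted values and Bellman equations -/

lemma PMF.sum_toReal {ι : Type*} [Fintype ι] (p : PMF ι) : ∑ i, (p i).toReal = 1 := by
  rw [← ENNReal.toReal_sum fun i _ => p.apply_ne_top i, ← tsum_fintype (L := .unconditional ι),
    p.tsum_coe, ENNReal.toReal_one]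

lemma PMF.sum_toReal_mul_le {ι : Type*} [Fintype ι] (p : PMF ι) {f g : ι → ℝ} {c : ℝ}
    (h : ∀ i ∈ p.support, f i ≤ g i + c) :
    ∑ i, (p i).toReal * f i ≤ ∑ i, (p i).toReal * g i + c := by
  calc ∑ i, (p i).toReal * f i ≤ ∑ i, ((p i).toReal * g i + (p i).toReal * c) := by
        refine Finset.sum_le_sum fun i _ => ?_
        rw [← mul_add]
        by_cases hi : p i = 0
        · simp [hi]
        · exact mul_le_mul_of_nonneg_left (h i hi) ENNReal.toReal_nonneg
    _ = _ := by rw [Finset.sum_add_distrib, ← Finset.sum_mul, p.sum_toReal, one_mul]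

lemma PMF.sum_toReal_mul_le_const {ι : Type*} [Fintype ι] (p : PMF ι) {f : ι → ℝ} {c : ℝ}
    (h : ∀ i ∈ p.support, f i ≤ c) : ∑ i, (p i).toReal * f i ≤ c := by
  simpa using p.sum_toReal_mul_le (f := f) (g := 0) (c := c) (by simpa using h)

lemma PMF.le_sum_toReal_mul {ι : Type*} [Fintype ι] (p : PMF ι) {f : ι → ℝ} {c : ℝ}
    (h : ∀ i ∈ p.support, c ≤ f i) : c ≤ ∑ i, (p i).toReal * f i := by
  have := p.sum_toReal_mul_le (f := 0) (g := f) (c := -c) (by simpa using h)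
  simp only [Pi.zero_apply, mul_zero, Finset.sum_const_zero] at this
  linarith

lemma PMF.sum_pure_mul {ι : Type*} [Fintype ι] (a : ι) (f : ι → ℝ) :
    ∑ i, (PMF.pure a i).toReal * f i = f a := by
  rw [Finset.sum_eq_single a] <;> simp +contextual [PMF.pure_apply]

lemma PMF.integral_bind {ι C : Type*} [Fintype ι] [MeasurableSpace C] (p : PMF ι) (f : ι → PMF C)
    {g : C → ℝ} (hg : ∀ i, Integrable g (f i).toMeasure) :
    ∫ c, g c ∂(p.bind f).toMeasure = ∑ i, (p i).toReal * ∫ c, g c ∂(f i).toMeasure := by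
  have h : (p.bind f).toMeasure = ∑ i, p i • (f i).toMeasure := by
    ext s hs
    rw [PMF.toMeasure_bind_apply _ _ _ hs, tsum_fintype]
    simp
  rw [h, integral_finsetSum_measure fun i _ => (hg i).smul_measure (p.apply_ne_top i)]
  simp

namespace RabinGame

open MarkovChain

variable {S A : Type*}

section Reward

variable {R : S → A → S → ℝ} {γ K : ℝ}

lemma abs_reward_term_le (hγ0 : 0 < γ) (hK : ∀ s a s', |R s a s'| ≤ K) (π : ℕ → Step S A) (t : ℕ) :
    ‖γ ^ t * R (π t).state (π t).action (π (t + 1)).state‖ ≤ γ ^ t * K := by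
  rw [norm_mul, norm_pow, Real.norm_of_nonneg hγ0.le]
  exact mul_le_mul_of_nonneg_left (hK _ _ _) (by positivity)

lemma summable_reward (hγ0 : 0 < γ) (hγ1 : γ < 1) (hK : ∀ s a s', |R s a s'| ≤ K)
    (π : ℕ → Step S A) :
    Summable fun t => γ ^ t * R (π t).state (π t).action (π (t + 1)).state :=
  Summable.of_norm_bounded ((summable_geometric_of_lt_one hγ0.le hγ1).mul_right K)
    (abs_reward_term_le hγ0 hK π)

lemma norm_discountedReward_le (hγ0 : 0 < γ) (hγ1 : γ < 1) (hK : ∀ s a s', |R s a s'| ≤ K)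
    (π : ℕ → Step S A) : ‖discountedReward R γ π‖ ≤ (1 - γ)⁻¹ * K :=
  tsum_of_norm_bounded ((hasSum_geometric_of_lt_one hγ0.le hγ1).mul_right K)
    (abs_reward_term_le hγ0 hK π)

lemma discountedReward_cons (hγ0 : 0 < γ) (hγ1 : γ < 1) (hK : ∀ s a s', |R s a s'| ≤ K)
    (p : Step S A) (π : ℕ → Step S A) :
    discountedReward R γ (cons p π) =
      R p.state p.action (π 0).state + γ * discountedReward R γ π := by
  rw [discountedReward, (summable_reward hγ0 hγ1 hK (cons p π)).tsum_eq_zero_add, discountedReward,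
    ← tsum_mul_left]
  simp [pow_succ', mul_assoc]

lemma measurable_discountedReward [Countable S] [Countable A] (hγ0 : 0 < γ) (hγ1 : γ < 1)
    (hK : ∀ s a s', |R s a s'| ≤ K) :
    Measurable (discountedReward R γ : (ℕ → Step S A) → ℝ) := by
  have : Countable (Step S A) :=
    Function.Injective.countable (f := fun c : Step S A => (c.state, c.action))
      fun ⟨_, _⟩ ⟨_, _⟩ h => by simpa using h
  have hlim (π : ℕ → Step S A) : Tendsto (fun n => ∑ t ∈ Finset.range n,
      γ ^ t * R (π t).state (π t).action (π (t + 1)).state) atTop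
      (nhds (discountedReward R γ π)) := by
    rw [discountedReward]
    exact (summable_reward hγ0 hγ1 hK π).hasSum.tendsto_sum_nat
  refine measurable_of_tendsto_metrizable (fun n => ?_) (tendsto_pi_nhds.2 hlim)
  refine Finset.measurable_sum _ fun t _ => measurable_const.mul ?_
  have h1 : Measurable fun π : ℕ → Step S A => (π t, π (t + 1)) :=
    (measurable_pi_apply t).prodMk (measurable_pi_apply (t + 1))
  exact (measurable_of_countable
    fun x : Step S A × Step S A => R x.1.state x.1.action x.2.state).comp h1

lemma exists_reward_bound [Finite S] [Finite A] (R : S → A → S → ℝ) :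
    ∃ K, ∀ s a s', |R s a s'| ≤ K := by
  obtain ⟨K, hK⟩ := (Set.finite_range fun x : S × A × S => |R x.1 x.2.1 x.2.2|).bddAbove
  exact ⟨K, fun s a s' => hK ⟨(s, a, s'), rfl⟩⟩

end Reward

variable [Fintype S] (G : RabinGame S A) (R : S → A → S → ℝ) (γ : ℝ)

/-- The expected reward of the action `a` at `s` if the states are worth `U` afterwards. -/
def lookahead (U : S → ℝ) (s : S) (a : A) : ℝ :=
  ∑ s', (G.trans s a s').toReal * (R s a s' + γ * U s')

lemma lookahead_le {G : RabinGame S A} {R : S → A → S → ℝ} {γ : ℝ} (hγ0 : 0 < γ)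
    {U U' : S → ℝ} {D : ℝ} (h : ∀ s, U s ≤ U' s + D) (s : S) (a : A) :
    G.lookahead R γ U s a ≤ G.lookahead R γ U' s a + γ * D := by
  refine PMF.sum_toReal_mul_le _ fun s' _ => ?_
  nlinarith [h s']

variable [Fintype A]

/-- The expected discounted reward from a state and a pair of memory states. -/
def entryValue (σ : G.SysStrategy) (τ : G.EnvStrategy) (s : S) (m : σ.Mem) (n : τ.Mem) : ℝ :=
  ∫ ω, discountedReward R γ (toRun ω) ∂G.entryLaw σ τ s m n

variable {G R γ} {σ : G.SysStrategy} {τ : G.EnvStrategy}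

lemma integrable_discountedReward (hγ0 : 0 < γ) (hγ1 : γ < 1)
    (μ : Measure (ℕ → Config S A σ.Mem τ.Mem)) [IsProbabilityMeasure μ] :
    Integrable (fun ω => discountedReward R γ (toRun ω)) μ := by
  obtain ⟨K, hK⟩ := exists_reward_bound R
  exact Integrable.of_bound
    ((measurable_discountedReward hγ0 hγ1 hK).comp measurable_toRun).aestronglyMeasurable
    ((1 - γ)⁻¹ * K) (ae_of_all _ fun ω => norm_discountedReward_le hγ0 hγ1 hK _)

lemma value_eq_entryValue (hγ0 : 0 < γ) (hγ1 : γ < 1) (s : S) :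
    G.value R γ s σ τ = G.entryValue R γ σ τ s σ.memInit τ.memInit := by
  obtain ⟨K, hK⟩ := exists_reward_bound R
  rw [value, runLaw_eq, entryValue, integral_map measurable_toRun.aemeasurable
    (measurable_discountedReward hγ0 hγ1 hK).aestronglyMeasurable]

lemma abs_entryValue_le (hγ0 : 0 < γ) (hγ1 : γ < 1) :
    ∃ B, ∀ (σ : G.SysStrategy) (τ : G.EnvStrategy) s m n, |G.entryValue R γ σ τ s m n| ≤ B := by
  obtain ⟨K, hK⟩ := exists_reward_bound R
  refine ⟨(1 - γ)⁻¹ * K, fun σ τ s m n => ?_⟩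
  have := norm_integral_le_of_norm_le_const (μ := G.entryLaw σ τ s m n)
    (ae_of_all _ fun ω => norm_discountedReward_le hγ0 hγ1 hK (toRun ω))
  simpa [entryValue] using this

/-- The Bellman equation for the value of a pair of strategies. -/
theorem entryValue_eq (hγ0 : 0 < γ) (hγ1 : γ < 1) (s : S) (m : σ.Mem) (n : τ.Mem) :
    G.entryValue R γ σ τ s m n = ∑ a, (G.actionDist σ τ s m n a).toReal *
      G.lookahead R γ (fun s' => G.entryValue R γ σ τ s' (σ.update s m) (τ.update s n)) s a := by
  obtain ⟨K, hK⟩ := exists_reward_bound R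
  -- In a configuration the action is already drawn, so `w` is the value given the first action;
  -- averaging over that action gives `entryValue`.
  let w (c : Config S A σ.Mem τ.Mem) : ℝ :=
    ∫ ω, discountedReward R γ (toRun ω) ∂law (G.stepDist σ τ) c
  have hw (c) : ‖w c‖ ≤ (1 - γ)⁻¹ * K := by
    have := norm_integral_le_of_norm_le_const (μ := law (G.stepDist σ τ) c)
      (ae_of_all _ fun ω => norm_discountedReward_le hγ0 hγ1 hK (toRun ω))
    simpa using this
  have hwi (p : PMF (Config S A σ.Mem τ.Mem)) : Integrable w p.toMeasure :=
    Integrable.of_bound (measurable_of_countable w).aestronglyMeasurable _ (ae_of_all _ hw)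
  have hentry (s m n) : G.entryValue R γ σ τ s m n = ∫ c, w c ∂(G.enter σ τ s m n).toMeasure :=
    integral_lawFrom _ _ (integrable_discountedReward hγ0 hγ1 _)
  have hstep (c) : w c = G.lookahead R γ (fun s' => G.entryValue R γ σ τ s'
      (σ.update c.state c.memSys) (τ.update c.state c.memEnv)) c.state c.action := by
    have h1 (c' : Config S A σ.Mem τ.Mem) :
        ∫ ω, discountedReward R γ (toRun (cons c ω)) ∂law (G.stepDist σ τ) c' =
          R c.state c.action c'.state + γ * w c' := by
      have : ∀ᵐ ω ∂law (G.stepDist σ τ) c', discountedReward R γ (toRun (cons c ω)) =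
          R c.state c.action c'.state + γ * discountedReward R γ (toRun ω) := by
        filter_upwards [ae_law_zero (G.stepDist σ τ) c'] with ω hω
        rw [toRun_cons, discountedReward_cons hγ0 hγ1 hK]
        simp [toRun, hω, Config.toStep]
      rw [integral_congr_ae this, integral_add (integrable_const _)
        ((integrable_discountedReward hγ0 hγ1 _).const_mul γ), integral_const_mul]
      simp [w]
    have hi (p : PMF (Config S A σ.Mem τ.Mem)) :
        Integrable (fun c' => R c.state c.action c'.state + γ * w c') p.toMeasure :=
      (Integrable.of_bound (measurable_of_countable _).aestronglyMeasurable K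
        (ae_of_all _ fun c' => hK _ _ _)).add ((hwi p).const_mul γ)
    change ∫ ω, discountedReward R γ (toRun ω) ∂law (G.stepDist σ τ) c = _
    rw [integral_law _ _ (integrable_discountedReward hγ0 hγ1 _)]
    simp_rw [h1]
    rw [stepDist, PMF.integral_bind _ _ fun _ => hi _, lookahead]
    refine Finset.sum_congr rfl fun s' _ => ?_
    congr 1
    have h2 : ∀ᵐ c' ∂(G.enter σ τ s' (σ.update c.state c.memSys)
        (τ.update c.state c.memEnv)).toMeasure,
        R c.state c.action c'.state + γ * w c' = R c.state c.action s' + γ * w c' := by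
      rw [ae_toMeasure_iff]
      intro c' hc'
      obtain ⟨a, -, rfl⟩ := (mem_support_enter ..).1 hc'
      rfl
    rw [integral_congr_ae h2, integral_add (integrable_const _) ((hwi _).const_mul γ),
      integral_const_mul, hentry]
    simp
  rw [hentry, enter, PMF.map, PMF.integral_bind _ _ fun _ => hwi _]
  refine Finset.sum_congr rfl fun a _ => ?_
  rw [Function.comp_apply, PMF.toMeasure_pure, integral_dirac, hstep]

/-- Comparison of approximate sub- and supersolutions of the Bellman equation of a pair of
strategies. -/
lemma le_of_bellman (hγ0 : 0 < γ) (hγ1 : γ < 1) {U U' : S → σ.Mem → τ.Mem → ℝ} {B B' κ : ℝ}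
    (hB : ∀ s m n, |U s m n| ≤ B) (hB' : ∀ s m n, |U' s m n| ≤ B')
    (hU : ∀ s m n, U s m n ≤ ∑ a, (G.actionDist σ τ s m n a).toReal *
      G.lookahead R γ (fun s' => U s' (σ.update s m) (τ.update s n)) s a + κ)
    (hU' : ∀ s m n, ∑ a, (G.actionDist σ τ s m n a).toReal *
      G.lookahead R γ (fun s' => U' s' (σ.update s m) (τ.update s n)) s a ≤ U' s m n)
    (s : S) (m : σ.Mem) (n : τ.Mem) : U s m n ≤ U' s m n + κ / (1 - γ) := by
  let f (x : S × σ.Mem × τ.Mem) : ℝ := U x.1 x.2.1 x.2.2 - U' x.1 x.2.1 x.2.2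
  have hbdd : BddAbove (Set.range f) := by
    refine ⟨B + B', ?_⟩
    rintro _ ⟨x, rfl⟩
    have h1 := (abs_le.1 (hB x.1 x.2.1 x.2.2)).2
    have h2 := (abs_le.1 (hB' x.1 x.2.1 x.2.2)).1
    simp only [f]
    linarith
  set D := ⨆ x, f x
  have hD (s m n) : U s m n ≤ U' s m n + D := by
    have : f (s, m, n) ≤ D := le_ciSup hbdd (s, m, n)
    simp only [f] at this
    linarith
  have hne : Nonempty (S × σ.Mem × τ.Mem) := ⟨(s, m, n)⟩
  have hD' : D ≤ γ * D + κ := by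
    refine ciSup_le fun ⟨s, m, n⟩ => ?_
    have h1 := hU s m n
    have h2 := hU' s m n
    have h3 := PMF.sum_toReal_mul_le (G.actionDist σ τ s m n) fun a _ =>
      lookahead_le (G := G) (R := R) hγ0
        (fun s' => hD s' (σ.update s m) (τ.update s n)) s a
    simp only [f]
    linarith
  have h1γ : 0 < 1 - γ := by linarith
  have : D ≤ κ / (1 - γ) := by
    rw [le_div_iff₀ h1γ]
    linarith
  linarith [hD s m n]

/-- The value of the pair solves its Bellman equation exactly, so it serves as the supersolution; an
error `κ` per step sums to `κ / (1 - γ)`. -/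
lemma le_entryValue (hγ0 : 0 < γ) (hγ1 : γ < 1) {U : S → σ.Mem → τ.Mem → ℝ} {B κ : ℝ}
    (hB : ∀ s m n, |U s m n| ≤ B)
    (hU : ∀ s m n, U s m n ≤ ∑ a, (G.actionDist σ τ s m n a).toReal *
      G.lookahead R γ (fun s' => U s' (σ.update s m) (τ.update s n)) s a + κ)
    (s : S) (m : σ.Mem) (n : τ.Mem) : U s m n ≤ G.entryValue R γ σ τ s m n + κ / (1 - γ) := by
  obtain ⟨B', hB'⟩ := abs_entryValue_le (G := G) (R := R) hγ0 hγ1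
  exact le_of_bellman hγ0 hγ1 hB (hB' σ τ) hU (fun s m n => (entryValue_eq hγ0 hγ1 s m n).ge) s m n

lemma entryValue_le (hγ0 : 0 < γ) (hγ1 : γ < 1) {U : S → σ.Mem → τ.Mem → ℝ} {B : ℝ}
    (hB : ∀ s m n, |U s m n| ≤ B)
    (hU : ∀ s m n, ∑ a, (G.actionDist σ τ s m n a).toReal *
      G.lookahead R γ (fun s' => U s' (σ.update s m) (τ.update s n)) s a ≤ U s m n)
    (s : S) (m : σ.Mem) (n : τ.Mem) : G.entryValue R γ σ τ s m n ≤ U s m n := by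
  obtain ⟨B', hB'⟩ := abs_entryValue_le (G := G) (R := R) hγ0 hγ1
  simpa using le_of_bellman hγ0 hγ1 (κ := 0) (hB' σ τ) hB
    (fun s m n => by simpa using (entryValue_eq hγ0 hγ1 s m n).le) hU s m n

/-- A solution of the optimality equation of the discounted game. -/
structure IsOptimalitySolution (G : RabinGame S A) (R : S → A → S → ℝ) (γ : ℝ) (W : S → ℝ) :
    Prop where
  sys_le : ∀ s ∈ G.sys, ∀ a ∈ G.avail s, G.lookahead R γ W s a ≤ W s
  sys_exists : ∀ s ∈ G.sys, ∃ a ∈ G.avail s, G.lookahead R γ W s a = W s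
  env_le : ∀ s ∉ G.sys, ∀ a ∈ G.avail s, W s ≤ G.lookahead R γ W s a
  env_exists : ∀ s ∉ G.sys, ∃ a ∈ G.avail s, G.lookahead R γ W s a = W s

/-- The optimality operator is a `γ`-contraction in the sup norm, so Banach's theorem gives a fixed
point; finiteness of `A` makes its suprema and infima attained. -/
lemma exists_optimalitySolution (G : RabinGame S A) (R : S → A → S → ℝ) (hγ0 : 0 < γ)
    (hγ1 : γ < 1) : ∃ W, IsOptimalitySolution G R γ W := by
  classical
  have hne (s) : Nonempty (G.avail s) := (G.avail_nonempty s).to_subtype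
  let Φ (U : S → ℝ) (s : S) : ℝ :=
    if s ∈ G.sys then ⨆ a : G.avail s, G.lookahead R γ U s a
    else ⨅ a : G.avail s, G.lookahead R γ U s a
  have hle (U U' : S → ℝ) (s : S) : Φ U s ≤ Φ U' s + γ * dist U U' := by
    have h (a : A) := lookahead_le (G := G) (R := R) hγ0 (U := U) (U' := U') (D := dist U U')
      (fun s => by
        have := (abs_le.1 ((Real.dist_eq _ _).symm.trans_le (dist_le_pi_dist U U' s))).2
        linarith) s a
    by_cases hs : s ∈ G.sys
    · simp only [Φ, hs, if_true]
      refine ciSup_le fun a => (h a).trans ?_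
      gcongr
      exact le_ciSup (f := fun a : G.avail s => G.lookahead R γ U' s a)
        (Set.finite_range _).bddAbove a
    · simp only [Φ, hs, if_false]
      rw [← sub_le_iff_le_add]
      refine le_ciInf fun a => ?_
      rw [sub_le_iff_le_add]
      refine le_trans ?_ (h a)
      exact ciInf_le (f := fun a : G.avail s => G.lookahead R γ U s a)
        (Set.finite_range _).bddBelow a
  have hcon : ContractingWith ⟨γ, hγ0.le⟩ Φ := by
    refine ⟨by exact_mod_cast hγ1, LipschitzWith.of_dist_le_mul fun U U' => ?_⟩
    refine (dist_pi_le_iff (by positivity)).2 fun s => ?_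
    rw [Real.dist_eq, abs_le]
    have h1 := hle U U' s
    have h2 := hle U' U s
    rw [dist_comm U' U] at h2
    constructor
    · change -(γ * dist U U') ≤ _
      linarith
    · change _ ≤ γ * dist U U'
      linarith
  refine ⟨ContractingWith.fixedPoint Φ hcon, ?_⟩
  have hfix := hcon.fixedPoint_isFixedPt
  set W := ContractingWith.fixedPoint Φ hcon
  have hW (s) : Φ W s = W s := congrFun hfix s
  have hsys {s} (hs : s ∈ G.sys) : ⨆ a : G.avail s, G.lookahead R γ W s a = W s := by
    simpa [Φ, hs] using hW s
  have henv {s} (hs : s ∉ G.sys) : ⨅ a : G.avail s, G.lookahead R γ W s a = W s := by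
    simpa [Φ, hs] using hW s
  refine ⟨fun s hs a ha => ?_, fun s hs => ?_, fun s hs a ha => ?_, fun s hs => ?_⟩
  · rw [← hsys hs]
    exact le_ciSup (f := fun a : G.avail s => G.lookahead R γ W s a)
      (Set.finite_range _).bddAbove ⟨a, ha⟩
  · obtain ⟨a, ha⟩ := exists_eq_ciSup_of_finite (f := fun a : G.avail s => G.lookahead R γ W s a)
    exact ⟨a, a.2, ha.trans (hsys hs)⟩
  · rw [← henv hs]
    exact ciInf_le (f := fun a : G.avail s => G.lookahead R γ W s a)
      (Set.finite_range _).bddBelow ⟨a, ha⟩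
  · obtain ⟨a, ha⟩ := exists_eq_ciInf_of_finite (f := fun a : G.avail s => G.lookahead R γ W s a)
    exact ⟨a, a.2, ha.trans (henv hs)⟩

end RabinGame

/-- Every distribution whose support contains `a` can be moved arbitrarily close to the point mass
at `a` without changing its support. -/
lemma PMF.exists_close_to_pure {ι : Type*} [Fintype ι] (p : PMF ι) {a : ι} (ha : a ∈ p.support)
    {δ : ℝ} (hδ0 : 0 < δ) (hδ1 : δ < 1) :
    ∃ p' : PMF ι, p'.support = p.support ∧ ∀ f : ι → ℝ,
      ∑ i, (p' i).toReal * f i = (1 - δ) * f a + δ * ∑ i, (p i).toReal * f i := by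
  classical
  have hsum : ∑ i, ENNReal.ofReal ((1 - δ) * (PMF.pure a i).toReal + δ * (p i).toReal) = 1 := by
    rw [← ENNReal.ofReal_sum_of_nonneg fun i _ => by
      have := hδ1.le
      have : 0 ≤ 1 - δ := by linarith
      positivity]
    rw [Finset.sum_add_distrib, ← Finset.mul_sum, ← Finset.mul_sum, PMF.sum_toReal, PMF.sum_toReal]
    simp
  have hnn (i : ι) : 0 ≤ (1 - δ) * (PMF.pure a i).toReal + δ * (p i).toReal := by
    have : 0 ≤ 1 - δ := by linarith
    positivity
  refine ⟨PMF.ofFintype _ hsum, ?_, fun f => ?_⟩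
  · ext i
    rw [PMF.support_ofFintype, PMF.mem_support_iff, Function.mem_support, ne_eq, ne_eq,
      ENNReal.ofReal_eq_zero, not_le]
    constructor
    · intro h hi
      have : i ≠ a := by
        rintro rfl
        exact (PMF.mem_support_iff _ _).1 ha hi
      simp [hi, PMF.pure_apply, this] at h
    · intro hi
      have h1 : 0 < (p i).toReal := ENNReal.toReal_pos hi (p.apply_ne_top i)
      have h2 : 0 ≤ (1 - δ) * (PMF.pure a i).toReal :=
        mul_nonneg (by linarith) ENNReal.toReal_nonneg
      have := mul_pos hδ0 h1
      linarith
  · simp_rw [PMF.ofFintype_apply, ENNReal.toReal_ofReal (hnn _), add_mul, mul_assoc,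
      Finset.sum_add_distrib, ← Finset.mul_sum, PMF.sum_pure_mul]

/-! ### The optimal value, perturbation towards optimal actions, and the gap argument -/

namespace RabinGame

lemma nonempty_envStrategy {S A : Type*} (G : RabinGame S A) : Nonempty G.EnvStrategy :=
  ⟨G.memorylessStrategy _ (fun s => PMF.pure (G.avail_nonempty s).some) fun s => by
    simpa using (G.avail_nonempty s).some_mem⟩

variable {S A : Type*} [Fintype S] {G : RabinGame S A} {R : S → A → S → ℝ} {γ : ℝ} {W : S → ℝ}

namespace IsOptimalitySolution

/-- One function holds a maximizer at system states and a minimizer at environment states; each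
player uses its own half. -/
lemma exists_greedy (h : IsOptimalitySolution G R γ W) :
    ∃ g : S → A, ∀ s, g s ∈ G.avail s ∧ G.lookahead R γ W s (g s) = W s := by
  have (s : S) : ∃ a, a ∈ G.avail s ∧ G.lookahead R γ W s a = W s := by
    by_cases hs : s ∈ G.sys
    · exact h.sys_exists s hs
    · exact h.env_exists s hs
  exact ⟨fun s => (this s).choose, fun s => (this s).choose_spec⟩

variable [Fintype A]

/-- An environment strategy that is optimal against every system strategy. -/
lemma exists_env (h : IsOptimalitySolution G R γ W) (hγ0 : 0 < γ) (hγ1 : γ < 1) :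
    ∃ τ : G.EnvStrategy, ∀ (σ : G.SysStrategy) s m n, G.entryValue R γ σ τ s m n ≤ W s := by
  obtain ⟨g, hg⟩ := h.exists_greedy
  let τ : G.EnvStrategy := G.memorylessStrategy G.sysᶜ (fun s => PMF.pure (g s)) fun s => by
    simpa using (hg s).1
  obtain ⟨B, hB⟩ := (Set.finite_range fun s => |W s|).bddAbove
  refine ⟨τ, fun σ s m n => entryValue_le hγ0 hγ1 (U := fun s _ _ => W s) (B := B)
    (fun s _ _ => hB ⟨s, rfl⟩) (fun s m n => ?_) s m n⟩
  by_cases hs : s ∈ G.sys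
  · rw [actionDist_sys hs]
    exact PMF.sum_toReal_mul_le_const _ fun a ha => h.sys_le s hs a (σ.choose_avail _ _ a ha)
  · rw [actionDist_env hs]
    exact ((PMF.sum_pure_mul (g s) _).trans (hg s).2).le

end IsOptimalitySolution

variable [Fintype A]

lemma strategyValue_le (hγ0 : 0 < γ) (hγ1 : γ < 1) (s : S) (σ : G.SysStrategy)
    (τ : G.EnvStrategy) :
    G.strategyValue R γ s σ ≤ G.entryValue R γ σ τ s σ.memInit τ.memInit := by
  rw [← value_eq_entryValue hγ0 hγ1]
  obtain ⟨B, hB⟩ := abs_entryValue_le (G := G) (R := R) hγ0 hγ1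
  refine ciInf_le ⟨-B, ?_⟩ τ
  rintro _ ⟨τ, rfl⟩
  change -B ≤ G.value R γ s σ τ
  rw [value_eq_entryValue hγ0 hγ1]
  exact (abs_le.1 (hB _ _ _ _ _)).1

lemma le_strategyValue (hγ0 : 0 < γ) (hγ1 : γ < 1) {s : S} {σ : G.SysStrategy} {c : ℝ}
    (h : ∀ τ : G.EnvStrategy, c ≤ G.entryValue R γ σ τ s σ.memInit τ.memInit) :
    c ≤ G.strategyValue R γ s σ := by
  have := nonempty_envStrategy G
  refine le_ciInf fun τ => ?_
  rw [value_eq_entryValue hγ0 hγ1]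
  exact h τ

namespace IsOptimalitySolution

/-- The greedy strategies form a saddle point: the environment's half keeps every system strategy
below `W`, and the system's half secures `W`. -/
theorem optimalValue_eq (h : IsOptimalitySolution G R γ W) (hγ0 : 0 < γ) (hγ1 : γ < 1) :
    G.optimalValue R γ = W := by
  funext s
  obtain ⟨g, hg⟩ := h.exists_greedy
  obtain ⟨τ, hτ⟩ := h.exists_env hγ0 hγ1
  let σ : G.SysStrategy := G.memorylessStrategy G.sys (fun s => PMF.pure (g s)) fun s => by
    simpa using (hg s).1
  have hle (σ : G.SysStrategy) : G.strategyValue R γ s σ ≤ W s :=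
    (strategyValue_le hγ0 hγ1 s σ τ).trans (hτ σ _ _ _)
  have : Nonempty G.SysStrategy := ⟨σ⟩
  refine le_antisymm (ciSup_le hle) ?_
  refine le_trans ?_ (le_ciSup (f := fun σ => G.strategyValue R γ s σ)
    ⟨W s, by rintro _ ⟨σ, rfl⟩; exact hle σ⟩ σ)
  refine le_strategyValue hγ0 hγ1 fun τ => ?_
  obtain ⟨B, hB⟩ := (Set.finite_range fun s => |W s|).bddAbove
  have := le_entryValue (R := R) (σ := σ) (τ := τ) hγ0 hγ1 (U := fun s _ _ => W s) (B := B) (κ := 0)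
    (fun s _ _ => hB ⟨s, rfl⟩) (fun s m n => ?_) s σ.memInit τ.memInit
  · simpa using this
  rw [add_zero]
  by_cases hs : s ∈ G.sys
  · rw [actionDist_sys hs]
    exact ((PMF.sum_pure_mul (g s) _).trans (hg s).2).ge
  · rw [actionDist_env hs]
    exact PMF.le_sum_toReal_mul _ fun a ha => h.env_le s hs a (τ.choose_avail _ _ a ha)

lemma mem_optimalActions (h : IsOptimalitySolution G R γ W) (hγ0 : 0 < γ) (hγ1 : γ < 1) {s : S}
    (hs : s ∈ G.sys) {a : A} :
    a ∈ G.optimalActions R γ s ↔ a ∈ G.avail s ∧ G.lookahead R γ W s a = W s := by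
  have hact (a) : G.actionValue R γ s a = G.lookahead R γ W s a := by
    rw [actionValue, lookahead, h.optimalValue_eq hγ0 hγ1]
  simp only [optimalActions, Set.mem_ofPred_eq, hact]
  refine and_congr_right fun ha => ⟨fun h1 => ?_, fun h1 b hb => h1 ▸ h.sys_le s hs b hb⟩
  obtain ⟨b, hb, hbW⟩ := h.sys_exists s hs
  exact (h.sys_le s hs a ha).antisymm (hbW ▸ h1 b hb)

end IsOptimalitySolution

/-- Moving a memoryless almost-sure winning strategy towards optimal actions that it allows yields
`ε`-optimal memoryless almost-sure winning strategies. -/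
theorem MemorylessWinningAllowsOptimal.exists_epsOptimal (hγ0 : 0 < γ) (hγ1 : γ < 1)
    (h : G.MemorylessWinningAllowsOptimal R γ) {ε : ℝ} (hε : 0 < ε) :
    ∃ σ : G.SysStrategy, σ.Memoryless ∧ G.AlmostSureWinning σ ∧ G.EpsOptimal R γ ε σ := by
  obtain ⟨σ, hσ, hwin, hopt⟩ := h
  obtain ⟨W, hW⟩ := exists_optimalitySolution G R hγ0 hγ1
  choose b hb using hopt
  obtain ⟨B₁, hB₁⟩ := (Set.finite_range fun s => |W s|).bddAbove
  obtain ⟨B₂, hB₂⟩ :=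
    (Set.finite_range fun x : S × A => |G.lookahead R γ W x.1 x.2|).bddAbove
  set B := max 0 (max B₁ B₂) with hBdef
  have hB0 : 0 ≤ B := le_max_left _ _
  have hBW (s) : |W s| ≤ B :=
    (hB₁ ⟨s, rfl⟩).trans ((le_max_left _ _).trans (le_max_right _ _))
  have hBL (s a) : |G.lookahead R γ W s a| ≤ B :=
    (hB₂ ⟨(s, a), rfl⟩).trans ((le_max_right _ _).trans (le_max_right _ _))
  have h1γ : 0 < 1 - γ := by linarith
  have hκ : 0 < ε * (1 - γ) := by positivity
  -- Mixing loses at most `2 * B * δ` per step, and a per-step loss of `ε * (1 - γ)` amounts to `ε`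
  -- in total. The summand `1` in the denominator covers `B = 0`.
  obtain ⟨δ, hδ0, hδ1, hδ⟩ : ∃ δ : ℝ, 0 < δ ∧ δ < 1 ∧ δ * (2 * B) ≤ ε * (1 - γ) := by
    refine ⟨min (1 / 2) (ε * (1 - γ) / (2 * B + 1)), by positivity,
      (min_le_left _ _).trans_lt (by norm_num), ?_⟩
    calc min (1 / 2) (ε * (1 - γ) / (2 * B + 1)) * (2 * B)
        ≤ ε * (1 - γ) / (2 * B + 1) * (2 * B + 1) := by
          gcongr
          · exact min_le_right _ _
          · linarith
      _ = ε * (1 - γ) := by field_simp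
  have hbs (s : G.sys) : b s ∈ (σ.choose s σ.memInit).support :=
    (PMF.mem_support_iff _ _).2 (hb s).1.2.ne'
  choose p hpsupp hpsum using fun s : G.sys =>
    (σ.choose s σ.memInit).exists_close_to_pure (hbs s) hδ0 hδ1
  let σ' : G.SysStrategy :=
    { Mem := Unit
      countable_mem := inferInstance
      memInit := ()
      choose := fun s _ => p s
      choose_avail := fun s _ a ha => σ.choose_avail s σ.memInit a (hpsupp s ▸ ha)
      update := fun _ _ => () }
  have hσ' : σ'.Memoryless := ⟨inferInstanceAs (Unique Unit)⟩
  refine ⟨σ', hσ', fun s hs => (hwin s hs).congr_support hσ hσ' hpsupp, fun s => ?_⟩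
  rw [hW.optimalValue_eq hγ0 hγ1]
  refine le_strategyValue hγ0 hγ1 fun τ => ?_
  have := le_entryValue (R := R) (σ := σ') (τ := τ) hγ0 hγ1 (U := fun s _ _ => W s) (B := B)
    (κ := ε * (1 - γ)) (fun s _ _ => hBW s) (fun s m n => ?_) s σ'.memInit τ.memInit
  · rw [mul_div_cancel_right₀ _ h1γ.ne'] at this
    linarith
  by_cases hs : s ∈ G.sys
  · rw [actionDist_sys hs]
    change W s ≤ ∑ a, (p ⟨s, hs⟩ a).toReal * G.lookahead R γ W s a + ε * (1 - γ)
    rw [hpsum, ((hW.mem_optimalActions hγ0 hγ1 hs).1 (hb ⟨s, hs⟩).2).2]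
    have h1 : -B ≤ ∑ a, (σ.choose ⟨s, hs⟩ σ.memInit a).toReal * G.lookahead R γ W s a :=
      PMF.le_sum_toReal_mul _ fun a _ => (abs_le.1 (hBL s a)).1
    have h2 := (abs_le.1 (hBW s)).2
    nlinarith
  · rw [actionDist_env hs]
    have := PMF.le_sum_toReal_mul (τ.choose ⟨s, hs⟩ n) fun a ha =>
      hW.env_le s hs a (τ.choose_avail _ _ a ha)
    linarith

/-- A memoryless strategy with a sufficiently good value allows an optimal action at every system
state. -/
theorem exists_eps_forall_allowed (hγ0 : 0 < γ) (hγ1 : γ < 1) :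
    ∃ ε : ℝ, 0 < ε ∧ ∀ σ : G.SysStrategy, G.EpsOptimal R γ ε σ →
      ∀ s : G.sys, (σ.allowed s ∩ G.optimalActions R γ s).Nonempty := by
  obtain ⟨W, hW⟩ := exists_optimalitySolution G R hγ0 hγ1
  obtain ⟨τ, hτ⟩ := hW.exists_env hγ0 hγ1
  -- Finitely many pairs of state and action have a common positive gap between the suboptimal ones
  -- and `W`.
  obtain ⟨η, hη0, hη⟩ : ∃ η : ℝ, 0 < η ∧ ∀ x : S × A, G.lookahead R γ W x.1 x.2 < W x.1 →
      G.lookahead R γ W x.1 x.2 ≤ W x.1 - η := by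
    have h1 : ∀ᶠ η in nhdsWithin (0 : ℝ) (Set.Ioi 0), ∀ x : S × A,
        G.lookahead R γ W x.1 x.2 < W x.1 → G.lookahead R γ W x.1 x.2 ≤ W x.1 - η := by
      refine eventually_all.2 fun x => ?_
      by_cases hx : G.lookahead R γ W x.1 x.2 < W x.1
      · filter_upwards [Ioo_mem_nhdsGT (sub_pos.2 hx)] with η hη _
        linarith [hη.2]
      · exact Eventually.of_forall fun _ h => absurd h hx
    obtain ⟨η, h2, h3⟩ := (h1.and self_mem_nhdsWithin).exists
    exact ⟨η, h3, h2⟩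
  refine ⟨η / 2, by positivity, fun σ hσ s => ?_⟩
  by_contra hempty
  rw [Set.not_nonempty_iff_eq_empty, Set.eq_empty_iff_forall_notMem] at hempty
  have h1 := hσ s
  rw [hW.optimalValue_eq hγ0 hγ1] at h1
  have h2 := strategyValue_le (R := R) hγ0 hγ1 (s : S) σ τ
  -- After the first step `τ` still holds the value below `W` in every memory state, so the
  -- first-step loss of `η` is never recovered.
  have h3 : G.entryValue R γ σ τ s σ.memInit τ.memInit ≤ W s - η := by
    rw [entryValue_eq hγ0 hγ1, actionDist_sys s.2]
    refine PMF.sum_toReal_mul_le_const _ fun a ha => ?_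
    have hav := σ.choose_avail s σ.memInit a ha
    have hle := lookahead_le (G := G) (R := R) hγ0
      (U := fun s' => G.entryValue R γ σ τ s' (σ.update s σ.memInit) (τ.update s τ.memInit))
      (U' := W) (D := 0) (fun s' => by simpa using hτ σ s' _ _) s a
    rw [mul_zero, add_zero] at hle
    refine hle.trans (hη (s, a) ((hW.sys_le s s.2 a hav).lt_of_ne fun heq => ?_))
    exact hempty a ⟨⟨hav, pos_iff_ne_zero.2 ((PMF.mem_support_iff _ _).1 ha)⟩,
      (hW.mem_optimalActions hγ0 hγ1 s.2).2 ⟨hav, heq⟩⟩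
  linarith

end RabinGame

/-! ### Playing optimally for finitely many steps, then switching to winning -/

namespace RabinGame

open MarkovChain

variable {S A : Type*} {G : RabinGame S A}

/-- The strategy that plays the actions `g` for `T` steps and then switches to the strategy
`σs (e s)`, where `s` is the state reached. A memory state `inl k` says that `k` steps remain before
the switch, and `inr ⟨i, m⟩` that `σs i` is played and is in memory state `m`. -/
abbrev switchStrategy {k : ℕ} (g : S → A) (hg : ∀ s, g s ∈ G.avail s) (e : S → Fin k)
    (σs : Fin k → G.SysStrategy) (T : ℕ) : G.SysStrategy where
  Mem := ℕ ⊕ Σ i, (σs i).Mem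
  countable_mem := inferInstance
  memInit := .inl T
  choose s
    | .inl 0 => (σs (e s)).choose s (σs (e s)).memInit
    | .inl (_ + 1) => PMF.pure (g s)
    | .inr ⟨i, m⟩ => (σs i).choose s m
  choose_avail s
    | .inl 0 => (σs (e s)).choose_avail s _
    | .inl (_ + 1) => by simpa using hg s
    | .inr ⟨i, m⟩ => (σs i).choose_avail s m
  update s
    | .inl 0 => .inr ⟨e s, (σs (e s)).update s (σs (e s)).memInit⟩
    | .inl (j + 1) => .inl j
    | .inr ⟨i, m⟩ => .inr ⟨i, (σs i).update s m⟩

section Switch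

variable {k : ℕ} {g : S → A} {hg : ∀ s, g s ∈ G.avail s} {e : S → Fin k}
  {σs : Fin k → G.SysStrategy} {T : ℕ} {τ : G.EnvStrategy}

/-- After the switch the chain is the image of the chain for `σs i` under the embedding `f` of
configurations, which leaves the run unchanged. -/
lemma winsEntry_switch_inr [Finite S] [Finite A] {i : Fin k} {s : S} {m : (σs i).Mem} {n : τ.Mem}
    (h : G.WinsEntry (σs i) τ s m n) :
    G.WinsEntry (switchStrategy g hg e σs T) τ s (.inr ⟨i, m⟩) n := by
  let f (c : Config S A (σs i).Mem τ.Mem) :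
      Config S A (switchStrategy g hg e σs T).Mem τ.Mem :=
    ⟨c.state, c.action, .inr ⟨i, c.memSys⟩, c.memEnv⟩
  have hact (s m n) : G.actionDist (switchStrategy g hg e σs T) τ s (.inr ⟨i, m⟩) n =
      G.actionDist (σs i) τ s m n := by
    by_cases hs : s ∈ G.sys
    · rw [actionDist_sys hs, actionDist_sys hs]
    · rw [actionDist_env hs, actionDist_env hs]
  have henter (s m n) : G.enter (switchStrategy g hg e σs T) τ s (.inr ⟨i, m⟩) n =
      (G.enter (σs i) τ s m n).map f := by
    rw [enter, enter, hact, PMF.map_comp]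
    rfl
  have hstep (c) : G.stepDist (switchStrategy g hg e σs T) τ (f c) =
      (G.stepDist (σs i) τ c).map f := by
    rw [stepDist, stepDist, PMF.map_bind]
    simp_rw [← henter]
    rfl
  have hmf : Measurable fun (ω : ℕ → Config S A (σs i).Mem τ.Mem) j => f (ω j) :=
    measurable_pi_iff.2 fun j => (measurable_from_top (f := f)).comp (measurable_pi_apply j)
  rw [WinsEntry, entryLaw, ae_lawFrom_iff _ _ measurableSet_toRun_winning] at h ⊢
  rw [henter]
  intro c' hc'
  obtain ⟨c, hc, rfl⟩ := (PMF.mem_support_map_iff _ _ _).1 hc'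
  rw [← law_map _ _ f hstep, ae_map_iff hmf.aemeasurable measurableSet_toRun_winning]
  exact h c hc

/-- Induction on the steps left before the switch. Memory `inl 0` already acts as the initial memory
of `σs (e s)`, and the environment arrives there with arbitrary memory. -/
lemma winsEntry_switch_inl [Finite S] [Finite A]
    (h : ∀ s, G.WinsFrom (σs (e s)) s) (j : ℕ) (s : S) (n : τ.Mem) :
    G.WinsEntry (switchStrategy g hg e σs T) τ s (.inl j) n := by
  induction j generalizing s n with
  | zero =>
    have hw := winsEntry_iff.1 ((h s).winsEntry τ n)
    refine winsEntry_iff.2 fun a ha s' hs' => winsEntry_switch_inr (hw a ?_ s' hs')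
    by_cases hs : s ∈ G.sys
    · rw [actionDist_sys hs] at ha ⊢
      exact ha
    · rw [actionDist_env hs] at ha ⊢
      exact ha
  | succ j ih => exact winsEntry_iff.2 fun a _ s' _ => ih s' _

end Switch

variable [Fintype S] [Fintype A] {R : S → A → S → ℝ} {γ : ℝ}

/-- If the system can win almost surely from every state, then some almost-sure winning strategy is
`ε`-optimal. -/
theorem exists_almostSureWinning_epsOptimal (hR : ∀ s a s', 0 ≤ R s a s') (hγ0 : 0 < γ)
    (hγ1 : γ < 1) (hreg : G.almostSureRegion = Set.univ) {ε : ℝ} (hε : 0 < ε) :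
    ∃ σ : G.SysStrategy, G.AlmostSureWinning σ ∧ G.EpsOptimal R γ ε σ := by
  obtain ⟨W, hW⟩ := exists_optimalitySolution G R hγ0 hγ1
  obtain ⟨g, hg⟩ := hW.exists_greedy
  obtain ⟨B, hB⟩ := (Set.finite_range fun s => |W s|).bddAbove
  have hBW (s) : |W s| ≤ max 0 B := (hB ⟨s, rfl⟩).trans (le_max_right _ _)
  set C := max 0 B
  have hC0 : 0 ≤ C := le_max_left _ _
  have hwin (s : S) : ∃ σ : G.SysStrategy, G.WinsFrom σ s := by
    have : s ∈ G.almostSureRegion := hreg ▸ Set.mem_univ s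
    exact this
  choose σw hσw using hwin
  let e := Fintype.equivFin S
  let σs (i : Fin (Fintype.card S)) : G.SysStrategy := σw (e.symm i)
  obtain ⟨T, hT⟩ : ∃ T : ℕ, γ ^ T * C ≤ ε := by
    have h1 : Tendsto (fun T : ℕ => γ ^ T * C) atTop (nhds (0 * C)) :=
      (tendsto_pow_atTop_nhds_zero_of_lt_one hγ0.le hγ1).mul_const C
    rw [zero_mul] at h1
    exact ((h1.eventually_lt_const hε).exists).imp fun T h => h.le
  let σ : G.SysStrategy := switchStrategy g (fun s => (hg s).1) e σs T
  refine ⟨σ, fun s _ => winsFrom_iff.2 fun τ => winsEntry_switch_inl (fun s => ?_) T s _,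
    fun s => ?_⟩
  · simpa [σs] using hσw s
  rw [hW.optimalValue_eq hγ0 hγ1]
  refine le_strategyValue hγ0 hγ1 fun τ => ?_
  -- A subsolution of the Bellman equation. After the switch nonnegative rewards guarantee `0`; with
  -- `j` steps left the deficit `C` is discounted `j` times. At `j = 0` the two match because `W s ≤
  -- C`.
  let U (s : S) : σ.Mem → τ.Mem → ℝ
    | .inl j, _ => W s - γ ^ j * C
    | .inr _, _ => 0
  have hlook0 (s a) : 0 ≤ G.lookahead R γ (fun _ => 0) s a :=
    PMF.le_sum_toReal_mul _ fun s' _ => by simpa using hR s a s'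
  have key := le_entryValue (R := R) (σ := σ) (τ := τ) hγ0 hγ1 (U := U) (B := C + C) (κ := 0) ?_ ?_
    s (.inl T) τ.memInit
  · rw [zero_div, add_zero] at key
    change W s - γ ^ T * C ≤ _ at key
    exact (sub_le_sub_left hT _).trans key
  · rintro s (j | x) n
    · change |W s - γ ^ j * C| ≤ C + C
      refine (abs_sub _ _).trans (add_le_add (hBW s) ?_)
      rw [abs_of_nonneg (by positivity)]
      exact mul_le_of_le_one_left hC0 (pow_le_one₀ hγ0.le hγ1.le)
    · change |(0 : ℝ)| ≤ C + C
      simpa using hC0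
  · rintro s ((_ | j) | ⟨i, m⟩) n
    · have h1 : 0 ≤ ∑ a, (G.actionDist σ τ s (.inl 0) n a).toReal *
          G.lookahead R γ (fun _ => 0) s a := PMF.le_sum_toReal_mul _ fun a _ => hlook0 s a
      have h2 : W s - γ ^ 0 * C ≤ 0 := by
        have := (abs_le.1 (hBW s)).2
        simpa using this
      rw [add_zero]
      exact h2.trans h1
    · have hstep (a : A) : G.lookahead R γ W s a - γ ^ (j + 1) * C ≤
          G.lookahead R γ (fun s' => W s' - γ ^ j * C) s a := by
        have := lookahead_le (G := G) (R := R) hγ0 (U := W) (U' := fun s' => W s' - γ ^ j * C)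
          (D := γ ^ j * C) (fun s' => by simp) s a
        rw [pow_succ']
        linarith
      have h1 : W s - γ ^ (j + 1) * C ≤ ∑ a, (G.actionDist σ τ s (.inl (j + 1)) n a).toReal *
          G.lookahead R γ (fun s' => W s' - γ ^ j * C) s a := by
        by_cases hs : s ∈ G.sys
        · rw [actionDist_sys hs]
          refine le_of_le_of_eq ?_ (PMF.sum_pure_mul (g s) _).symm
          have := hstep (g s)
          rwa [(hg s).2] at this
        · rw [actionDist_env hs]
          refine PMF.le_sum_toReal_mul _ fun a ha => ?_
          have := hW.env_le s hs a (τ.choose_avail _ _ a ha)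
          linarith [hstep a]
      rw [add_zero]
      exact h1
    · have h1 : 0 ≤ ∑ a, (G.actionDist σ τ s (.inr ⟨i, m⟩) n a).toReal *
          G.lookahead R γ (fun _ => 0) s a := PMF.le_sum_toReal_mul _ fun a _ => hlook0 s a
      rw [add_zero]
      exact h1

end RabinGame

end

theorem theorem3 {S A : Type*} [Fintype S] [Finite A] (G : RabinGame S A)
    (R : S → A → S → ℝ) (hR : ∀ s a s', 0 ≤ R s a s') (γ : ℝ) (hγ0 : 0 < γ) (hγ1 : γ < 1) :
    (G.almostSureRegion = Set.univ →
      ((∀ ε : ℝ, 0 < ε → G.Suffices RabinGame.Strategy.Memoryless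
          (fun σ => G.AlmostSureWinning σ ∧ G.EpsOptimal R γ ε σ)) ↔
        G.MemorylessWinningAllowsOptimal R γ)) ∧
    ((∀ ε : ℝ, 0 < ε → ∃ σ : G.SysStrategy,
          σ.Memoryless ∧ G.AlmostSureWinning σ ∧ G.EpsOptimal R γ ε σ) ↔
        G.MemorylessWinningAllowsOptimal R γ) := by
  have := Fintype.ofFinite A
  have main : (∀ ε : ℝ, 0 < ε → ∃ σ : G.SysStrategy,
      σ.Memoryless ∧ G.AlmostSureWinning σ ∧ G.EpsOptimal R γ ε σ) ↔
        G.MemorylessWinningAllowsOptimal R γ := by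
    refine ⟨fun h => ?_, fun h ε hε => h.exists_epsOptimal hγ0 hγ1 hε⟩
    obtain ⟨ε, hε, hall⟩ := RabinGame.exists_eps_forall_allowed (G := G) (R := R) hγ0 hγ1
    obtain ⟨σ, hσ, hwin, hopt⟩ := h ε hε
    exact ⟨σ, hσ, hwin, hall σ hopt⟩
  -- Sufficiency yields memoryless strategies only once some strategy meets the objective; the
  -- switching strategy supplies it.
  refine ⟨fun hreg => ⟨fun h => main.1 fun ε hε => h ε hε ?_, fun h ε hε _ => main.2 h ε hε⟩, main⟩
  exact RabinGame.exists_almostSureWinning_epsOptimal hR hγ0 hγ1 hreg hε
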